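/- Let $n\ge 1$ and let $q\in\mathbb{C}$ be non-zero and not a root of unity. Fix $\hbar\in\mathbb{C}$ with $e^{\hbar}=q$ and put $q^z=e^{\hbar z}$ for $z\in\mathbb{C}$. Write $[x,y]_a=xy-a\,yx$ and $[x,y]=[x,y]_1$. Let $\mathfrak{g}=\mathfrak{so}(2n+1)$ with Cartan subalgebra $\mathfrak h$; let $\varepsilon_1,\dots,\varepsilon_n$ be the orthonormal basis of $\mathfrak h^*$ of short positive roots, $\alpha_1=\varepsilon_1$ and $\alpha_i=\varepsilon_i-\varepsilon_{i-1}$ ($2\le i\le n$) the simple roots, $\rho$ the half-sum of the positive roots, and $\alpha^\vee=2\alpha/(\alpha,\alpha)$. Let $U_q(\mathfrak g)$ be the $\mathbb C$-algebra generated by $e_{\alpha_i},f_{\alpha_i},q^{\pm h_{\alpha_i}}$, $1\le i\le n$, with the relations: $q^{h_{\alpha_i}}q^{-h_{\alpha_i}}=1=q^{-h_{\alpha_i}}q^{h_{\alpha_i}}$; the $q^{h_{\alpha_i}}$ commute with each other; $q^{h_{\alpha_i}}e_{\alpha_j}=q^{(\alpha_i,\alpha_j)}e_{\alpha_j}q^{h_{\alpha_i}}$;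 $q^{h_{\alpha_i}}f_{\alpha_j}=q^{-(\alpha_i,\alpha_j)}f_{\alpha_j}q^{h_{\alpha_i}}$; $[e_{\alpha_i},f_{\alpha_j}]=\delta_{ij}\,(q^{h_{\alpha_i}}-q^{-h_{\alpha_i}})/(q-q^{-1})$; and, for $x=e$ and for $x=f$, the Serre relations $[x_{\alpha_i},[x_{\alpha_i},x_{\alpha_j}]_q]_{q^{-1}}=0$ if $2(\alpha_i,\alpha_j)=-(\alpha_i,\alpha_i)$, $[x_{\alpha_i},x_{\alpha_j}]=0$ if $(\alpha_i,\alpha_j)=0$, and, if $n\ge2$, $[x_{\alpha_1},[x_{\alpha_1},[x_{\alpha_1},x_{\alpha_2}]_q]_{q^{-1}}]=0$. Let $U_q(\mathfrak g_-)$ be the subalgebra generated by the $f_{\alpha_i}$. Let $\sigma$ be the algebra automorphism with $e_{\alpha_i}\mapsto f_{\alpha_i}$, $f_{\alpha_i}\mapsto e_{\alpha_i}$, $q^{\pm h_{\alpha_i}}\mapsto q^{\mp h_{\alpha_i}}$, and $\omega$ the algebra anti-automorphism with $e_{\alpha_i}\mapsto f_{\alpha_i}$, $f_{\alpha_i}\mapsto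 e_{\alpha_i}$, $q^{\pm h_{\alpha_i}}\mapsto q^{\pm h_{\alpha_i}}$. Put $f_{\varepsilon_1}=f_{\alpha_1}$ and $f_{\varepsilon_{i+1}}=[f_{\varepsilon_i},f_{\alpha_{i+1}}]_{q^{-1}}$ for $1\le i<n$. Let $\lambda\in\mathfrak h^*$ satisfy $q^{2(\lambda,\varepsilon_i)}=-q^{-1}$ for all $i$ and $(\lambda,\alpha_i)=0$ for $i>1$. The base module $M$ is the quotient of the Verma module of highest weight $\lambda$, with canonical generator $1_\lambda$, by the submodule generated by $f_{\alpha_i}1_\lambda$ for $i>1$ and, if $n\ge 2$, by $[f_{\alpha_1},[f_{\alpha_1},f_{\alpha_2}]_q]_{q^{-1}}1_\lambda$; the image of $1_\lambda$ in $M$ is again denoted $1_\lambda$. A contravariant form on $M$ is a $\mathbb C$-bilinear form with $(1_\lambda,1_\lambda)=1$ and $(ax,y)=(x,\omega(a)y)$ for all $a\in U_q(\mathfrak g)$ and $x,y\in M$. Let $V$ be a finite-dimensional $U_q(\mathfrak g)$-module of highest weight $\nu\in\mathfrak h^*$, where $\ell_i=(\nu+\rho,\alpha_i^\vee)-1\in\mathbb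 Z_{\ge 0}$ for $i=1,\dots,n$. Let $I^-_V$ be the left ideal of $U_q(\mathfrak g_-)$ generated by $f_{\alpha_i}^{\ell_i+1}$, $i=1,\dots,n$; put $I^+_V=\sigma(I^-_V)$ and $M^+_V=\{x\in M: I^+_Vx=0\}$, and let $\omega(I^+_V)M$ be the linear span of all $\omega(a)x$ with $a\in I^+_V$, $x\in M$. Then $M$ has exactly one contravariant form; its restriction to $M^+_V$ is non-degenerate; $M=M^+_V\oplus\omega(I^+_V)M$, and the two summands are orthogonal with respect to the form; and $$M^+_V=\mathrm{Span}\{f_{\varepsilon_1}^{m_1}\cdots f_{\varepsilon_n}^{m_n}1_\lambda : m_i\le\ell_i \text{ for all } i\},\qquad \omega(I^+_V)M=\mathrm{Span}\{f_{\varepsilon_1}^{k_1}\cdots f_{\varepsilon_n}^{k_n}1_\lambda : k_i>\ell_i\text{ for some } i\},$$ where the exponents are non-negative integers. -/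

import Mathlib

/-- The twisted commutator `[x, y]_a = x y - a y x`. -/
def qComm {A : Type*} [Ring A] [Algebra ℂ A] (a : ℂ) (x y : A) : A :=
  x * y - a • (y * x)

/-- The simple roots of `so(2n+1)` in the orthonormal basis `ε` of short roots (indices start
at `0`): `α_0 = ε_0` and `α_i = ε_i - ε_{i-1}` for `i > 0`. -/
def simpleRoot (n : ℕ) (i : Fin n) : Fin n → ℤ := fun k =>
  (if (k : ℕ) = i then 1 else 0) - (if (k : ℕ) + 1 = i then 1 else 0)

/-- The integer `(α_i, α_j)`. -/
def rootForm (n : ℕ) (i j : Fin n) : ℤ :=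
  ∑ k, simpleRoot n i k * simpleRoot n j k

/-- The number `(μ, α_i)` for a weight `μ`, given by its coordinates in the basis `ε`. -/
def weightRoot {n : ℕ} (μ : Fin n → ℂ) (i : Fin n) : ℂ :=
  ∑ k, μ k * (simpleRoot n i k : ℂ)

/-- The number `(μ, α_i^∨)`, where `α^∨ = 2 α / (α, α)`. -/
noncomputable def weightCoroot {n : ℕ} (μ : Fin n → ℂ) (i : Fin n) : ℂ :=
  2 * weightRoot μ i / (rootForm n i i : ℂ)

/-- Half the sum of the positive roots `ε_i` and `ε_i - ε_j`, `ε_i + ε_j` with `j < i`. -/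
noncomputable def weylRho (n : ℕ) : Fin n → ℂ :=
  (1 / 2 : ℂ) • ((∑ i, Pi.single i 1) +
    ∑ i, ∑ j ∈ Finset.univ.filter (fun j : Fin n => j < i),
      ((Pi.single i 1 - Pi.single j 1) + (Pi.single i 1 + Pi.single j 1)))

/-- The generators `e_α`, `f_α`, `q^{h_α}`, `q^{-h_α}` of the quantum group, `α` simple. -/
inductive UqGen (n : ℕ) : Type
  | e (i : Fin n) : UqGen n
  | f (i : Fin n) : UqGen n
  | k (i : Fin n) : UqGen n
  | kinv (i : Fin n) : UqGen n

/-- A generator inside the free algebra. -/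
def freeGen {n : ℕ} (x : UqGen n) : FreeAlgebra ℂ (UqGen n) := FreeAlgebra.ι ℂ x

open UqGen in
/-- The defining relations of `U_q(so(2n+1))`. -/
inductive UqRel (n : ℕ) (q : ℂ) :
    FreeAlgebra ℂ (UqGen n) → FreeAlgebra ℂ (UqGen n) → Prop
  | k_kinv (i : Fin n) : UqRel n q (freeGen (k i) * freeGen (kinv i)) 1
  | kinv_k (i : Fin n) : UqRel n q (freeGen (kinv i) * freeGen (k i)) 1
  | k_k (i j : Fin n) :
      UqRel n q (freeGen (k i) * freeGen (k j)) (freeGen (k j) * freeGen (k i))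
  | k_e (i j : Fin n) : UqRel n q (freeGen (k i) * freeGen (e j))
      (q ^ rootForm n i j • (freeGen (e j) * freeGen (k i)))
  | k_f (i j : Fin n) : UqRel n q (freeGen (k i) * freeGen (f j))
      (q ^ (-rootForm n i j) • (freeGen (f j) * freeGen (k i)))
  | e_f_same (i : Fin n) :
      UqRel n q (freeGen (e i) * freeGen (f i) - freeGen (f i) * freeGen (e i))
        ((q - q⁻¹)⁻¹ • (freeGen (k i) - freeGen (kinv i)))
  | e_f_ne (i j : Fin n) (h : i ≠ j) :
      UqRel n q (freeGen (e i) * freeGen (f j)) (freeGen (f j) * freeGen (e i))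
  | serre_e (i j : Fin n) (h : 2 * rootForm n i j = -rootForm n i i) :
      UqRel n q
        (qComm q⁻¹ (freeGen (e i)) (qComm q (freeGen (e i)) (freeGen (e j)))) 0
  | serre_f (i j : Fin n) (h : 2 * rootForm n i j = -rootForm n i i) :
      UqRel n q
        (qComm q⁻¹ (freeGen (f i)) (qComm q (freeGen (f i)) (freeGen (f j)))) 0
  | comm_e (i j : Fin n) (h : rootForm n i j = 0) :
      UqRel n q (qComm 1 (freeGen (e i)) (freeGen (e j))) 0
  | comm_f (i j : Fin n) (h : rootForm n i j = 0) :
      UqRel n q (qComm 1 (freeGen (f i)) (freeGen (f j))) 0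
  | serre_short_e (h0 : 0 < n) (h1 : 1 < n) :
      UqRel n q (qComm 1 (freeGen (e ⟨0, h0⟩)) (qComm q⁻¹ (freeGen (e ⟨0, h0⟩))
        (qComm q (freeGen (e ⟨0, h0⟩)) (freeGen (e ⟨1, h1⟩))))) 0
  | serre_short_f (h0 : 0 < n) (h1 : 1 < n) :
      UqRel n q (qComm 1 (freeGen (f ⟨0, h0⟩)) (qComm q⁻¹ (freeGen (f ⟨0, h0⟩))
        (qComm q (freeGen (f ⟨0, h0⟩)) (freeGen (f ⟨1, h1⟩))))) 0

/-- The quantum group `U_q(so(2n+1))` as an algebra over `ℂ`. -/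
def Uq (n : ℕ) (q : ℂ) : Type := RingQuot (UqRel n q)

noncomputable instance (n : ℕ) (q : ℂ) : Ring (Uq n q) :=
  inferInstanceAs (Ring (RingQuot (UqRel n q)))

noncomputable instance (n : ℕ) (q : ℂ) : Algebra ℂ (Uq n q) :=
  inferInstanceAs (Algebra ℂ (RingQuot (UqRel n q)))

/-- The projection of the free algebra onto `U_q(so(2n+1))`. -/
noncomputable def uqMk (n : ℕ) (q : ℂ) : FreeAlgebra ℂ (UqGen n) →ₐ[ℂ] Uq n q :=
  RingQuot.mkAlgHom ℂ (UqRel n q)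

lemma uqMk_rel {n : ℕ} {q : ℂ} {x y : FreeAlgebra ℂ (UqGen n)} (h : UqRel n q x y) :
    uqMk n q x = uqMk n q y :=
  RingQuot.mkAlgHom_rel ℂ h

/-- An algebra homomorphism out of `U_q(so(2n+1))`, from images of the generators. -/
noncomputable def uqLift {n : ℕ} {q : ℂ} {A : Type*} [Ring A] [Algebra ℂ A] (g : UqGen n → A)
    (hg : ∀ ⦃x y : FreeAlgebra ℂ (UqGen n)⦄, UqRel n q x y →
      FreeAlgebra.lift ℂ g x = FreeAlgebra.lift ℂ g y) : Uq n q →ₐ[ℂ] A :=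
  RingQuot.liftAlgHom ℂ ⟨FreeAlgebra.lift ℂ g, hg⟩

/-- The class of a generator in `U_q(so(2n+1))`. -/
noncomputable def uqGen (n : ℕ) (q : ℂ) (x : UqGen n) : Uq n q :=
  uqMk n q (freeGen x)

/-- `e_{α_i}` -/
noncomputable abbrev uqE (n : ℕ) (q : ℂ) (i : Fin n) : Uq n q := uqGen n q (UqGen.e i)

/-- `f_{α_i}` -/
noncomputable abbrev uqF (n : ℕ) (q : ℂ) (i : Fin n) : Uq n q := uqGen n q (UqGen.f i)

/-- `q^{h_{α_i}}` -/
noncomputable abbrev uqK (n : ℕ) (q : ℂ) (i : Fin n) : Uq n q := uqGen n q (UqGen.k i)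

/-- `q^{-h_{α_i}}` -/
noncomputable abbrev uqKinv (n : ℕ) (q : ℂ) (i : Fin n) : Uq n q := uqGen n q (UqGen.kinv i)

lemma uqLift_gen {n : ℕ} {q : ℂ} {A : Type*} [Ring A] [Algebra ℂ A] (g : UqGen n → A)
    (hg : ∀ ⦃x y : FreeAlgebra ℂ (UqGen n)⦄, UqRel n q x y →
      FreeAlgebra.lift ℂ g x = FreeAlgebra.lift ℂ g y) (x : UqGen n) :
    uqLift g hg (uqGen n q x) = g x := by
  have h := RingQuot.liftAlgHom_mkAlgHom_apply (S := ℂ) (FreeAlgebra.lift ℂ g) hg (freeGen x)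
  refine Eq.trans h ?_
  simp [freeGen]

section Relations

variable {n : ℕ} {q : ℂ}

lemma mk_qComm (a : ℂ) (x y : FreeAlgebra ℂ (UqGen n)) :
    uqMk n q (qComm a x y) =
      qComm a (uqMk n q x) (uqMk n q y) := by
  simp [qComm]

lemma uq_k_kinv (i : Fin n) : uqK n q i * uqKinv n q i = 1 := by
  simpa [uqGen] using uqMk_rel (UqRel.k_kinv (q := q) i)

lemma uq_kinv_k (i : Fin n) : uqKinv n q i * uqK n q i = 1 := by
  simpa [uqGen] using uqMk_rel (UqRel.kinv_k (q := q) i)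

lemma uq_k_k (i j : Fin n) : uqK n q i * uqK n q j = uqK n q j * uqK n q i := by
  simpa [uqGen] using uqMk_rel (UqRel.k_k (q := q) i j)

lemma uq_k_e (i j : Fin n) :
    uqK n q i * uqE n q j = q ^ rootForm n i j • (uqE n q j * uqK n q i) := by
  simpa [uqGen] using uqMk_rel (UqRel.k_e (q := q) i j)

lemma uq_k_f (i j : Fin n) :
    uqK n q i * uqF n q j = q ^ (-rootForm n i j) • (uqF n q j * uqK n q i) := by
  simpa [uqGen] using uqMk_rel (UqRel.k_f (q := q) i j)

lemma uq_e_f_same (i : Fin n) :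
    uqE n q i * uqF n q i - uqF n q i * uqE n q i =
      (q - q⁻¹)⁻¹ • (uqK n q i - uqKinv n q i) := by
  simpa [uqGen] using uqMk_rel (UqRel.e_f_same (q := q) i)

lemma uq_e_f_ne (i j : Fin n) (h : i ≠ j) :
    uqE n q i * uqF n q j = uqF n q j * uqE n q i := by
  simpa [uqGen] using uqMk_rel (UqRel.e_f_ne (q := q) i j h)

lemma uq_serre_e (i j : Fin n) (h : 2 * rootForm n i j = -rootForm n i i) :
    qComm q⁻¹ (uqE n q i) (qComm q (uqE n q i) (uqE n q j)) = 0 := by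
  simpa [uqGen, mk_qComm] using uqMk_rel (UqRel.serre_e (q := q) i j h)

lemma uq_serre_f (i j : Fin n) (h : 2 * rootForm n i j = -rootForm n i i) :
    qComm q⁻¹ (uqF n q i) (qComm q (uqF n q i) (uqF n q j)) = 0 := by
  simpa [uqGen, mk_qComm] using uqMk_rel (UqRel.serre_f (q := q) i j h)

lemma uq_comm_e (i j : Fin n) (h : rootForm n i j = 0) :
    qComm 1 (uqE n q i) (uqE n q j) = 0 := by
  simpa [uqGen, mk_qComm] using uqMk_rel (UqRel.comm_e (q := q) i j h)

lemma uq_comm_f (i j : Fin n) (h : rootForm n i j = 0) :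
    qComm 1 (uqF n q i) (uqF n q j) = 0 := by
  simpa [uqGen, mk_qComm] using uqMk_rel (UqRel.comm_f (q := q) i j h)

lemma uq_serre_short_e (h0 : 0 < n) (h1 : 1 < n) :
    qComm 1 (uqE n q ⟨0, h0⟩) (qComm q⁻¹ (uqE n q ⟨0, h0⟩)
      (qComm q (uqE n q ⟨0, h0⟩) (uqE n q ⟨1, h1⟩))) = 0 := by
  simpa [uqGen, mk_qComm] using uqMk_rel (UqRel.serre_short_e (q := q) h0 h1)

lemma uq_serre_short_f (h0 : 0 < n) (h1 : 1 < n) :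
    qComm 1 (uqF n q ⟨0, h0⟩) (qComm q⁻¹ (uqF n q ⟨0, h0⟩)
      (qComm q (uqF n q ⟨0, h0⟩) (uqF n q ⟨1, h1⟩))) = 0 := by
  simpa [uqGen, mk_qComm] using uqMk_rel (UqRel.serre_short_f (q := q) h0 h1)

lemma uq_kinv_comm (i : Fin n) (x : Uq n q) (c : ℂ) (hc : c ≠ 0)
    (h : uqK n q i * x = c • (x * uqK n q i)) :
    uqKinv n q i * x = c⁻¹ • (x * uqKinv n q i) := by
  have h2 : uqKinv n q i * (uqK n q i * x) * uqKinv n q i =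
      c • (uqKinv n q i * x * (uqK n q i * uqKinv n q i)) := by
    rw [h]; simp [mul_assoc]
  rw [← mul_assoc, uq_kinv_k, uq_k_kinv, one_mul, mul_one] at h2
  rw [h2, smul_smul, inv_mul_cancel₀ hc, one_smul]

lemma uq_kinv_kinv (i j : Fin n) :
    uqKinv n q i * uqKinv n q j = uqKinv n q j * uqKinv n q i := by
  have h1 := uq_kinv_comm (q := q) i (uqK n q j) 1 one_ne_zero (by simpa using uq_k_k i j)
  have h2 := uq_kinv_comm (q := q) j (uqKinv n q i) 1 one_ne_zero
    (by simpa using h1.symm)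
  simpa using h2.symm

end Relations

/-- The images of the generators under `σ`. -/
noncomputable def sigmaGen (n : ℕ) (q : ℂ) : UqGen n → Uq n q
  | UqGen.e i => uqF n q i
  | UqGen.f i => uqE n q i
  | UqGen.k i => uqKinv n q i
  | UqGen.kinv i => uqK n q i

/-- The images of the generators under `ω`. -/
noncomputable def omegaGen (n : ℕ) (q : ℂ) : UqGen n → (Uq n q)ᵐᵒᵖ
  | UqGen.e i => MulOpposite.op (uqF n q i)
  | UqGen.f i => MulOpposite.op (uqE n q i)
  | UqGen.k i => MulOpposite.op (uqK n q i)
  | UqGen.kinv i => MulOpposite.op (uqKinv n q i)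

lemma sigmaGen_rel (n : ℕ) (q : ℂ) (hq : q ≠ 0) ⦃x y : FreeAlgebra ℂ (UqGen n)⦄
    (h : UqRel n q x y) :
    FreeAlgebra.lift ℂ (sigmaGen n q) x = FreeAlgebra.lift ℂ (sigmaGen n q) y := by
  have key : ∀ z, FreeAlgebra.lift ℂ (sigmaGen n q) (freeGen z) = sigmaGen n q z := fun z => by
    simp [freeGen]
  have keyq : ∀ (a : ℂ) (z w), FreeAlgebra.lift ℂ (sigmaGen n q) (qComm a z w) =
      qComm a (FreeAlgebra.lift ℂ (sigmaGen n q) z) (FreeAlgebra.lift ℂ (sigmaGen n q) w) :=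
    fun a z w => by simp [qComm]
  cases h <;> simp only [map_mul, map_sub, map_smul, map_one, map_zero, key, keyq, sigmaGen]
  case k_kinv i => exact uq_kinv_k i
  case kinv_k i => exact uq_k_kinv i
  case k_k i j => exact uq_kinv_kinv i j
  case k_e i j =>
    rw [uq_kinv_comm i _ _ (zpow_ne_zero _ hq) (uq_k_f i j), zpow_neg, inv_inv]
  case k_f i j =>
    rw [uq_kinv_comm i _ _ (zpow_ne_zero _ hq) (uq_k_e i j), zpow_neg]
  case e_f_same i =>
    rw [← neg_sub, uq_e_f_same, ← smul_neg, neg_sub]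
  case e_f_ne i j h => exact (uq_e_f_ne j i h.symm).symm
  case serre_e i j h => exact uq_serre_f i j h
  case serre_f i j h => exact uq_serre_e i j h
  case comm_e i j h => exact uq_comm_f i j h
  case comm_f i j h => exact uq_comm_e i j h
  case serre_short_e h0 h1 => exact uq_serre_short_f h0 h1
  case serre_short_f h0 h1 => exact uq_serre_short_e h0 h1

/-- The involutive algebra automorphism `σ`: `e_α ↦ f_α`, `f_α ↦ e_α`,
`q^{±h_α} ↦ q^{∓h_α}`. -/
noncomputable def uqSigma (n : ℕ) (q : ℂ) (hq : q ≠ 0) : Uq n q →ₐ[ℂ] Uq n q :=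
  uqLift (sigmaGen n q) (sigmaGen_rel n q hq)

lemma uqSigma_gen (n : ℕ) (q : ℂ) (hq : q ≠ 0) (x : UqGen n) :
    uqSigma n q hq (uqGen n q x) = sigmaGen n q x :=
  uqLift_gen _ _ x

lemma qComm_op {A : Type*} [Ring A] [Algebra ℂ A] (a b : ℂ) (x y : A) :
    qComm a (MulOpposite.op x) (qComm b (MulOpposite.op x) (MulOpposite.op y)) =
      MulOpposite.op (y * x * x - (a + b) • (x * y * x) + (a * b) • (x * x * y)) := by
  apply MulOpposite.unop_injective
  simp only [qComm, MulOpposite.unop_sub, MulOpposite.unop_mul, MulOpposite.unop_smul,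
    MulOpposite.unop_op, mul_sub, sub_mul, mul_smul_comm, smul_mul_assoc,
    smul_sub, smul_smul, add_smul, mul_assoc]
  abel

lemma qComm_expand {A : Type*} [Ring A] [Algebra ℂ A] (a b : ℂ) (x y : A) :
    qComm a x (qComm b x y) =
      x * x * y - (a + b) • (x * y * x) + (a * b) • (y * x * x) := by
  simp only [qComm, mul_sub, sub_mul, mul_smul_comm, smul_mul_assoc,
    smul_sub, smul_smul, add_smul, mul_assoc]
  abel

lemma qComm_op_inv {A : Type*} [Ring A] [Algebra ℂ A] (q : ℂ) (hq : q ≠ 0) (x y : A) :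
    qComm q⁻¹ (MulOpposite.op x) (qComm q (MulOpposite.op x) (MulOpposite.op y)) =
      MulOpposite.op (qComm q⁻¹ x (qComm q x y)) := by
  rw [qComm_op, qComm_expand, inv_mul_cancel₀ hq, one_smul, one_smul]
  congr 1
  abel

lemma qComm_op_one {A : Type*} [Ring A] [Algebra ℂ A] (x y : A) :
    qComm 1 (MulOpposite.op x) (MulOpposite.op y) = -MulOpposite.op (qComm 1 x y) := by
  simp [qComm]

lemma omegaGen_rel (n : ℕ) (q : ℂ) (hq : q ≠ 0) ⦃x y : FreeAlgebra ℂ (UqGen n)⦄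
    (h : UqRel n q x y) :
    FreeAlgebra.lift ℂ (omegaGen n q) x = FreeAlgebra.lift ℂ (omegaGen n q) y := by
  have key : ∀ z, FreeAlgebra.lift ℂ (omegaGen n q) (freeGen z) = omegaGen n q z := fun z => by
    simp [freeGen]
  have keyq : ∀ (a : ℂ) (z w), FreeAlgebra.lift ℂ (omegaGen n q) (qComm a z w) =
      qComm a (FreeAlgebra.lift ℂ (omegaGen n q) z) (FreeAlgebra.lift ℂ (omegaGen n q) w) :=
    fun a z w => by simp [qComm]
  cases h <;> simp only [map_mul, map_sub, map_smul, map_one, map_zero, key, keyq, omegaGen,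
    qComm_op_inv q hq, qComm_op_one, ← MulOpposite.op_mul, ← MulOpposite.op_sub,
    ← MulOpposite.op_smul]
  case k_kinv i => rw [uq_kinv_k, MulOpposite.op_one]
  case kinv_k i => rw [uq_k_kinv, MulOpposite.op_one]
  case k_k i j => rw [uq_k_k]
  case k_e i j =>
    rw [uq_k_f, smul_smul, ← zpow_add₀ hq, add_neg_cancel, zpow_zero, one_smul]
  case k_f i j =>
    rw [uq_k_e, smul_smul, ← zpow_add₀ hq, neg_add_cancel, zpow_zero, one_smul]
  case e_f_same i => rw [uq_e_f_same]
  case e_f_ne i j h => rw [uq_e_f_ne j i h.symm]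
  case serre_e i j h => rw [uq_serre_f i j h, MulOpposite.op_zero]
  case serre_f i j h => rw [uq_serre_e i j h, MulOpposite.op_zero]
  case comm_e i j h => rw [uq_comm_f i j h, MulOpposite.op_zero, neg_zero]
  case comm_f i j h => rw [uq_comm_e i j h, MulOpposite.op_zero, neg_zero]
  case serre_short_e h0 h1 => rw [uq_serre_short_f h0 h1, MulOpposite.op_zero, neg_zero]
  case serre_short_f h0 h1 => rw [uq_serre_short_e h0 h1, MulOpposite.op_zero, neg_zero]

/-- The algebra anti-automorphism `ω`: `e_α ↦ f_α`, `f_α ↦ e_α`, `q^{±h_α} ↦ q^{±h_α}`,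
as a homomorphism to the opposite algebra. -/
noncomputable def uqOmega (n : ℕ) (q : ℂ) (hq : q ≠ 0) : Uq n q →ₐ[ℂ] (Uq n q)ᵐᵒᵖ :=
  uqLift (omegaGen n q) (omegaGen_rel n q hq)

lemma uqOmega_gen (n : ℕ) (q : ℂ) (hq : q ≠ 0) (x : UqGen n) :
    uqOmega n q hq (uqGen n q x) = omegaGen n q x :=
  uqLift_gen _ _ x

/-- The subalgebra `U_q(g_-)` generated by the `f_α`, `α` simple. -/
noncomputable def uqMinus (n : ℕ) (q : ℂ) : Subalgebra ℂ (Uq n q) :=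
  Algebra.adjoin ℂ (Set.range (uqF n q))

/-- The generator `f_{α_i}` as an element of `U_q(g_-)`. -/
noncomputable def uqMinusF (n : ℕ) (q : ℂ) (i : Fin n) : uqMinus n q :=
  ⟨uqF n q i, Algebra.subset_adjoin (Set.mem_range_self i)⟩

/-- The root vectors `f_{ε_i}`: `f_{ε_0} = f_{α_0}`,
`f_{ε_{k+1}} = [f_{ε_k}, f_{α_{k+1}}]_{q⁻¹}`. -/
noncomputable def uqFEps (n : ℕ) (q : ℂ) : (k : ℕ) → k < n → Uq n q
  | 0, h => uqF n q ⟨0, h⟩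
  | k + 1, h => qComm q⁻¹ (uqFEps n q k (Nat.lt_of_succ_lt h)) (uqF n q ⟨k + 1, h⟩)

/-- The ordered monomial `f_{ε_0}^{m_0} ⋯ f_{ε_{n-1}}^{m_{n-1}}`. -/
noncomputable def uqMonomial (n : ℕ) (q : ℂ) (m : Fin n → ℕ) : Uq n q :=
  (List.ofFn fun i : Fin n => uqFEps n q i i.isLt ^ m i).prod

/-- The left ideal of `U_q(g)` generated by `e_α` and `q^{h_α} - q^{(λ, α)}`, `α` simple;
here `q^z` is `exp (ħ z)`. -/
noncomputable def vermaIdeal (n : ℕ) (q ħ : ℂ) (wt : Fin n → ℂ) : Submodule (Uq n q) (Uq n q) :=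
  Submodule.span (Uq n q) (Set.range (uqE n q) ∪
    Set.range fun i => uqK n q i - algebraMap ℂ (Uq n q) (Complex.exp (ħ * weightRoot wt i)))

/-- The Verma module of highest weight `wt`. -/
abbrev Verma (n : ℕ) (q ħ : ℂ) (wt : Fin n → ℂ) : Type := Uq n q ⧸ vermaIdeal n q ħ wt

/-- The canonical generator of the Verma module. -/
noncomputable def vermaVec (n : ℕ) (q ħ : ℂ) (wt : Fin n → ℂ) : Verma n q ħ wt :=
  Submodule.Quotient.mk 1

/-- The submodule of the Verma module generated by the vectors `f_{α_i} 1_λ`, `i > 0`, and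
(when the rank is at least `2`) by `[f_{α_0}, [f_{α_0}, f_{α_1}]_q]_{q⁻¹} 1_λ`. -/
noncomputable def baseSubmodule (n : ℕ) (q ħ : ℂ) (wt : Fin n → ℂ) :
    Submodule (Uq n q) (Verma n q ħ wt) :=
  Submodule.span (Uq n q)
    ({x | ∃ i : Fin n, 0 < (i : ℕ) ∧ x = uqF n q i • vermaVec n q ħ wt} ∪
     {x | ∃ (h0 : 0 < n) (h1 : 1 < n), x = qComm q⁻¹ (uqF n q ⟨0, h0⟩)
        (qComm q (uqF n q ⟨0, h0⟩) (uqF n q ⟨1, h1⟩)) • vermaVec n q ħ wt})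

/-- The base module `M`. -/
abbrev BaseModule (n : ℕ) (q ħ : ℂ) (wt : Fin n → ℂ) : Type :=
  Verma n q ħ wt ⧸ baseSubmodule n q ħ wt

/-- The image of the canonical generator in the base module. -/
noncomputable def baseVec (n : ℕ) (q ħ : ℂ) (wt : Fin n → ℂ) : BaseModule n q ħ wt :=
  Submodule.Quotient.mk (vermaVec n q ħ wt)

/-- A `ℂ`-bilinear form on the base module is the contravariant (Shapovalov) form if
`(1_λ, 1_λ) = 1` and `(a x, y) = (x, ω(a) y)` for all `a` in `U_q(g)`. -/
def IsContravariantForm {n : ℕ} {q : ℂ} (hq : q ≠ 0) {ħ : ℂ} {wt : Fin n → ℂ}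
    (B : LinearMap.BilinForm ℂ (BaseModule n q ħ wt)) : Prop :=
  B (baseVec n q ħ wt) (baseVec n q ħ wt) = 1 ∧
    ∀ (a : Uq n q) (x y : BaseModule n q ħ wt),
      B (a • x) y = B x ((uqOmega n q hq a).unop • y)

/-- A `U_q(g)`-module `V` is of highest weight `ν` if it is generated by a nonzero vector of
weight `ν` that is annihilated by all `e_α`. -/
def IsOfHighestWeight {n : ℕ} {q : ℂ} (ħ : ℂ) (ν : Fin n → ℂ)
    (V : Type*) [AddCommGroup V] [Module (Uq n q) V] : Prop :=
  ∃ v : V, v ≠ 0 ∧ (∀ i, uqE n q i • v = 0) ∧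
    (∀ i, uqK n q i • v =
      algebraMap ℂ (Uq n q) (Complex.exp (ħ * weightRoot ν i)) • v) ∧
    Submodule.span (Uq n q) {v} = ⊤

/-- The left ideal `I^-` of `U_q(g_-)` generated by the elements `f_{α_i}^{ℓ_i + 1}`. -/
noncomputable def idealMinus (n : ℕ) (q : ℂ) (l : Fin n → ℕ) : Ideal (uqMinus n q) :=
  Ideal.span (Set.range fun i => uqMinusF n q i ^ (l i + 1))

/-- The set `I^+ = σ(I^-)`. -/
noncomputable def idealPlus (n : ℕ) (q : ℂ) (hq : q ≠ 0) (l : Fin n → ℕ) : Set (Uq n q) :=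
  (fun x : uqMinus n q => uqSigma n q hq x) '' (idealMinus n q l : Set (uqMinus n q))

/-- The kernel of `I^+` in a module `M`. -/
noncomputable def plusKernel {n : ℕ} {q : ℂ} (hq : q ≠ 0) (l : Fin n → ℕ)
    (M : Type*) [AddCommGroup M] [Module ℂ M] [Module (Uq n q) M]
    [IsScalarTower ℂ (Uq n q) M] : Submodule ℂ M where
  carrier := {x | ∀ a ∈ idealPlus n q hq l, a • x = 0}
  add_mem' hx hy a ha := by rw [smul_add, hx a ha, hy a ha, add_zero]
  zero_mem' a _ := smul_zero a
  smul_mem' c x hx a ha := by rw [smul_algebra_smul_comm, hx a ha, smul_zero]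

/-- The subspace `ω(I^+) M` of a module `M`. -/
noncomputable def omegaImage {n : ℕ} {q : ℂ} (hq : q ≠ 0) (l : Fin n → ℕ)
    (M : Type*) [AddCommGroup M] [Module ℂ M] [Module (Uq n q) M] : Submodule ℂ M :=
  Submodule.span ℂ
    {y | ∃ a ∈ idealPlus n q hq l, ∃ x : M, y = (uqOmega n q hq a).unop • x}

/-! The base module is a `q`-oscillator (Fock) module in disguise, and in that model every claim can
be read off from supports.

Spanning: the defects `epsDefect q f i j`, which measure the failure of `f_{ε_j} f_{ε_i} = q⁻¹
f_{ε_i} f_{ε_j}` for `i < j`, need not vanish in the quantum group but kill all of `M`. The vectors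
killed by every defect form a subspace that contains `1_λ` and is stable under each `f_α`
(`isDefectFree_of_killed`, `isDefectFree_smul`). The delicate point is stability under the short
root vector, `epsDefect_one_two_smul`, where `q` not being a root of unity is needed. Since words in
the `f_α` span `M` (`wordSpan_eq_top`), the ordered monomials span it too
(`span_uqMonomial_eq_top`).

Independence: on the space with basis `x_m`, `m ∈ ℤⁿ`, let `f_{α_i}` shift `m` by `α_i` with
coefficient `[m_{i-1}]` (or `1` for the short root), and let `e_{α_i}` shift by `-α_i` with
coefficient `[m_i]`, rescaled by `γ` for the short root. The condition `q^{2(λ,ε_i)} = -q⁻¹` is what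
makes this a representation (`fock_e_f_same`). Sending `1_λ` to `x_0` defines a homomorphism
(`nonempty_fockMap`) that takes the monomial of exponent `m` to a nonzero multiple of `x_m`
(`exists_map_uqMonomial`). It is therefore injective, and `M` is identified with the span of the
`x_m`, `m ∈ ℕⁿ`.

In these coordinates `e_{α_i}^p` kills exactly the vectors supported on `m_i < p`, and the image of
`f_{α_i}^p` is the span of the `x_m` with `m_i ≥ p`; with `p = ℓ_i + 1` this gives `plusKernel_eq`
and `omegaImage_eq`. The contravariant form is diagonal with nonzero entries `fockNorm`, so its
restriction to any coordinate subspace is non-degenerate and complementary coordinate subspaces are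
orthogonal. -/

/-! ### Commutation of the root vectors with the generators in the negative part -/

section NegativePart

variable {A : Type*} [Ring A] [Algebra ℂ A]

/-- The root vectors built from a sequence `f` by iterated `q⁻¹`-commutators. -/
noncomputable def epsVec (q : ℂ) (f : ℕ → A) : ℕ → A
  | 0 => f 0
  | k + 1 => qComm q⁻¹ (epsVec q f k) (f (k + 1))

/-- The defect of the `q`-commutation of two root vectors. -/
noncomputable def epsDefect (q : ℂ) (f : ℕ → A) (i j : ℕ) : A :=
  qComm q⁻¹ (epsVec q f j) (epsVec q f i)

/-- The cubic Serre polynomial. -/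
noncomputable def serrePoly (q : ℂ) (x y : A) : A :=
  x * x * y - (q + q⁻¹) • (x * y * x) + y * x * x

/-- The Serre relations of the negative part, for a sequence of generators. -/
structure IsSerreSeq (q : ℂ) (f : ℕ → A) : Prop where
  comm : ∀ i j, i + 2 ≤ j → f i * f j = f j * f i
  serre_up : ∀ i, serrePoly q (f (i + 1)) (f (i + 2)) = 0
  serre_down : ∀ i, serrePoly q (f (i + 1)) (f i) = 0
  short : f 0 * serrePoly q (f 0) (f 1) = serrePoly q (f 0) (f 1) * f 0

lemma serrePoly_qComm (q r : ℂ) {a b c : A} (hab : a * b = b * a) :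
    serrePoly q b (qComm r a c) = qComm r a (serrePoly q b c) := by
  have hab' : ∀ z, a * (b * z) = b * (a * z) := fun z => by rw [← mul_assoc, hab, mul_assoc]
  simp only [serrePoly, qComm, mul_sub, sub_mul, mul_add, add_mul, mul_smul_comm, smul_mul_assoc,
    mul_assoc, hab, hab', smul_sub]
  module

/-- Expanded, the difference of the two sides is exactly the Serre polynomial. -/
lemma qComm_mul_right_of_serre {q : ℂ} (hq : q ≠ 0) {a b : A} (h : serrePoly q b a = 0) :
    qComm q⁻¹ a b * b = q • (b * qComm q⁻¹ a b) := by
  simp only [serrePoly, qComm, mul_sub, sub_mul, mul_smul_comm, smul_mul_assoc, mul_assoc,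
    smul_sub, smul_smul, mul_inv_cancel₀ hq] at h ⊢
  linear_combination (norm := module) h

/-- The type `A₃` identity for the middle node: the two Serre relations for `b`, multiplied by `a`
or `c` on either side, combine to `q + q⁻¹` times the claim. -/
lemma commute_qComm_qComm_of_serre {q : ℂ} (hq : q ≠ 0) (hs : q + q⁻¹ ≠ 0) {a b c : A}
    (hac : a * c = c * a) (ha : serrePoly q b a = 0) (hc : serrePoly q b c = 0) :
    b * qComm q⁻¹ (qComm q⁻¹ a b) c = qComm q⁻¹ (qComm q⁻¹ a b) c * b := by
  have hac' : ∀ z, a * (c * z) = c * (a * z) := fun z => by rw [← mul_assoc, hac, mul_assoc]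
  have h1 := congrArg (· * c) ha
  have h2 := congrArg (c * ·) ha
  have h3 := congrArg (· * a) hc
  have h4 := congrArg (a * ·) hc
  simp only [serrePoly, qComm, mul_sub, sub_mul, mul_add, add_mul, mul_smul_comm, smul_mul_assoc,
    mul_assoc, smul_sub, smul_smul, hac, hac', zero_mul, mul_zero] at h1 h2 h3 h4 ⊢
  rw [← sub_eq_zero]
  apply (smul_right_injective A hs)
  simp only [smul_zero]
  linear_combination (norm := skip) (-1 : ℂ) • h1 + (q⁻¹ * q⁻¹) • h2 - (q⁻¹ * q⁻¹) • h3 + h4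
  match_scalars <;> field_simp <;> ring

variable {q : ℂ} {f : ℕ → A}

lemma epsVec_succ (k : ℕ) : epsVec q f k * f (k + 1) =
    q⁻¹ • (f (k + 1) * epsVec q f k) + epsVec q f (k + 1) := by
  simp [epsVec, qComm]

namespace IsSerreSeq

lemma epsVec_comm_gt (hf : IsSerreSeq q f) {i k : ℕ} (h : i + 2 ≤ k) :
    epsVec q f i * f k = f k * epsVec q f i := by
  induction i with
  | zero => exact hf.comm 0 k h
  | succ i ih =>
    have h1 : Commute (epsVec q f i) (f k) := ih (by omega)
    have h2 : Commute (f (i + 1)) (f k) := hf.comm _ _ h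
    exact (((h1.mul_left h2).sub_left ((h2.mul_left h1).smul_left q⁻¹))).eq

lemma serrePoly_epsVec (hf : IsSerreSeq q f) (k : ℕ) :
    serrePoly q (f (k + 1)) (epsVec q f k) = 0 := by
  cases k with
  | zero => exact hf.serre_down 0
  | succ k =>
    rw [epsVec, serrePoly_qComm _ _ (hf.epsVec_comm_gt le_rfl), hf.serre_down]
    simp [qComm]

lemma epsVec_mul_self (hf : IsSerreSeq q f) (hq : q ≠ 0) (k : ℕ) :
    epsVec q f (k + 1) * f (k + 1) = q • (f (k + 1) * epsVec q f (k + 1)) :=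
  qComm_mul_right_of_serre hq (hf.serrePoly_epsVec k)

lemma epsVec_comm_lt (hf : IsSerreSeq q f) (hq : q ≠ 0) (hs : q + q⁻¹ ≠ 0) {i k : ℕ}
    (h : k + 2 ≤ i) : epsVec q f i * f (k + 1) = f (k + 1) * epsVec q f i := by
  induction i, h using Nat.le_induction with
  | base =>
    exact (commute_qComm_qComm_of_serre hq hs (hf.epsVec_comm_gt le_rfl)
      (hf.serrePoly_epsVec k) (hf.serre_up k)).symm
  | succ i h ih =>
    have h1 : Commute (epsVec q f i) (f (k + 1)) := ih
    have h2 : Commute (f (i + 1)) (f (k + 1)) := (hf.comm _ _ (by omega)).symm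
    exact (((h1.mul_left h2).sub_left ((h2.mul_left h1).smul_left q⁻¹))).eq

lemma epsVec_mul_of_ne (hf : IsSerreSeq q f) (hq : q ≠ 0) (hs : q + q⁻¹ ≠ 0) {i k : ℕ}
    (h1 : i ≠ k) (h2 : i ≠ k + 1) : epsVec q f i * f (k + 1) = f (k + 1) * epsVec q f i := by
  rcases Nat.lt_or_ge i k with h | h
  · exact hf.epsVec_comm_gt (by omega)
  · exact hf.epsVec_comm_lt hq hs (by omega)

/-- Only `f_{k+1}` next to `f_{ε_k}` produces a new root vector; every other pair commutes up to a
scalar. -/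
lemma exists_epsVec_mul (hf : IsSerreSeq q f) (hq : q ≠ 0) (hs : q + q⁻¹ ≠ 0) {i k : ℕ}
    (h1 : i ≠ k) : ∃ c : ℂ, epsVec q f i * f (k + 1) = c • (f (k + 1) * epsVec q f i) := by
  by_cases h2 : i = k + 1
  · exact ⟨q, by rw [h2, hf.epsVec_mul_self hq]⟩
  · exact ⟨1, by rw [one_smul, hf.epsVec_mul_of_ne hq hs h1 h2]⟩

lemma epsDefect_mul_of_ne (hf : IsSerreSeq q f) (hq : q ≠ 0) (hs : q + q⁻¹ ≠ 0) {i j k : ℕ}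
    (h1 : i ≠ k) (h2 : j ≠ k) :
    ∃ c : ℂ, epsDefect q f i j * f (k + 1) = c • (f (k + 1) * epsDefect q f i j) := by
  obtain ⟨c, hc⟩ := hf.exists_epsVec_mul hq hs h1
  obtain ⟨d, hd⟩ := hf.exists_epsVec_mul hq hs h2
  refine ⟨c * d, ?_⟩
  have hc' : ∀ z, epsVec q f i * (f (k + 1) * z) = c • (f (k + 1) * (epsVec q f i * z)) :=
    fun z => by rw [← mul_assoc, hc, smul_mul_assoc, mul_assoc]
  have hd' : ∀ z, epsVec q f j * (f (k + 1) * z) = d • (f (k + 1) * (epsVec q f j * z)) :=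
    fun z => by rw [← mul_assoc, hd, smul_mul_assoc, mul_assoc]
  simp only [epsDefect, qComm, mul_sub, sub_mul, mul_smul_comm, smul_mul_assoc, mul_assoc, hc, hd,
    hc', hd']
  module

/-- Moving `f_{j+1}` across a defect raises its larger index. Together with `epsDefect_mul_left`,
which raises the smaller one, this reaches every defect from the pair `(0, 1)`. -/
lemma epsDefect_mul_right (hf : IsSerreSeq q f) {i j : ℕ} (h : i < j) :
    epsDefect q f i j * f (j + 1) =
      q⁻¹ • (f (j + 1) * epsDefect q f i j) + epsDefect q f i (j + 1) := by
  have hc := hf.epsVec_comm_gt (i := i) (k := j + 1) (by omega)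
  have hc' : ∀ z, epsVec q f i * (f (j + 1) * z) = f (j + 1) * (epsVec q f i * z) :=
    fun z => by rw [← mul_assoc, hc, mul_assoc]
  have hd := epsVec_succ (q := q) (f := f) j
  simp only [epsDefect, qComm, mul_sub, sub_mul, mul_add, mul_smul_comm, smul_mul_assoc,
    mul_assoc, hc, hd, hc']
  simp only [← mul_assoc, hd]
  simp only [add_mul, mul_assoc, smul_mul_assoc]
  module

lemma epsDefect_mul_left (hf : IsSerreSeq q f) (hq : q ≠ 0) (hs : q + q⁻¹ ≠ 0) {i j : ℕ}
    (h : i + 1 < j) :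
    epsDefect q f i j * f (i + 1) =
      q⁻¹ • (f (i + 1) * epsDefect q f i j) + epsDefect q f (i + 1) j := by
  have hc := hf.epsVec_comm_lt hq hs h
  have hc' : ∀ z, epsVec q f j * (f (i + 1) * z) = f (i + 1) * (epsVec q f j * z) :=
    fun z => by rw [← mul_assoc, hc, mul_assoc]
  have hd := epsVec_succ (q := q) (f := f) i
  have hd' : ∀ z, epsVec q f i * (f (i + 1) * z) =
      q⁻¹ • (f (i + 1) * (epsVec q f i * z)) + epsVec q f (i + 1) * z :=
    fun z => by rw [← mul_assoc, hd, add_mul, smul_mul_assoc, mul_assoc]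
  simp only [epsDefect, qComm, mul_sub, sub_mul, mul_add, mul_smul_comm, smul_mul_assoc,
    mul_assoc, hc, hd, hc', hd', smul_add]
  module

/-- Raising `i` to `i + 1` here would create two squares of `f_{ε_{i+1}}`, and they cancel. -/
lemma epsDefect_mul_mid (hf : IsSerreSeq q f) (hq : q ≠ 0) (i : ℕ) :
    epsDefect q f i (i + 1) * f (i + 1) = f (i + 1) * epsDefect q f i (i + 1) := by
  have hc := hf.epsVec_mul_self hq i
  have hc' : ∀ z, epsVec q f (i + 1) * (f (i + 1) * z) =
      q • (f (i + 1) * (epsVec q f (i + 1) * z)) :=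
    fun z => by rw [← mul_assoc, hc, smul_mul_assoc, mul_assoc]
  have hd := epsVec_succ (q := q) (f := f) i
  have hd' : ∀ z, epsVec q f i * (f (i + 1) * z) =
      q⁻¹ • (f (i + 1) * (epsVec q f i * z)) + epsVec q f (i + 1) * z :=
    fun z => by rw [← mul_assoc, hd, add_mul, smul_mul_assoc, mul_assoc]
  simp only [epsDefect, qComm, mul_sub, sub_mul, mul_add, mul_smul_comm, smul_mul_assoc,
    mul_assoc, hc, hd, hc', hd', smul_add, smul_smul, inv_mul_cancel₀ hq, mul_inv_cancel₀ hq,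
    one_smul]
  module

/-- The first defect is the quadratic Serre element of the short root: merely commuting with `f 0`
in the algebra, but one of the elements imposed to kill `1_λ`. -/
lemma epsDefect_zero_one (hq : q ≠ 0) :
    epsDefect q f 0 1 = -q⁻¹ • serrePoly q (f 0) (f 1) := by
  simp only [epsDefect, serrePoly, epsVec, qComm, mul_sub, sub_mul, mul_smul_comm, smul_mul_assoc,
    mul_assoc, smul_sub, smul_smul, smul_add, zero_add]
  match_scalars <;> field_simp
  ring

lemma epsDefect_zero_comm (hf : IsSerreSeq q f) (hq : q ≠ 0) {j : ℕ} (hj : 1 ≤ j) :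
    f 0 * epsDefect q f 0 j = epsDefect q f 0 j * f 0 := by
  induction j, hj using Nat.le_induction with
  | base => rw [epsDefect_zero_one hq, mul_smul_comm, hf.short, smul_mul_assoc]
  | succ j hj ih =>
    have h := hf.epsDefect_mul_right hj
    rw [← sub_eq_iff_eq_add'] at h
    rw [← h]
    have h1 : Commute (f 0) (epsDefect q f 0 j) := ih
    have h2 : Commute (f 0) (f (j + 1)) := hf.comm _ _ (by omega)
    exact ((h1.mul_right h2).sub_right ((h2.mul_right h1).smul_right q⁻¹)).eq

end IsSerreSeq

end NegativePart

/-! ### Stability of the subspace killed by all defects -/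

section DefectKernel

variable {A : Type*} [Ring A] [Algebra ℂ A] {N : Type*} [AddCommGroup N] [Module ℂ N] [Module A N]
  [IsScalarTower ℂ A N] {q : ℂ} {f : ℕ → A}

/-- The vectors on which the root vectors `q`-commute. -/
def IsDefectFree (q : ℂ) (f : ℕ → A) (x : N) : Prop :=
  ∀ i j, i < j → epsDefect q f i j • x = 0

namespace IsSerreSeq

/-- In `a f_{k+1} = q⁻¹ f_{k+1} a + c`, a vector killed by both `f_{k+1}` and `a` is killed by `c`;
the index-raising relations then climb from `(0, 1)` to every pair. -/
lemma isDefectFree_of_killed (hf : IsSerreSeq q f) (hq : q ≠ 0) (hs : q + q⁻¹ ≠ 0) {x : N}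
    (h0 : epsDefect q f 0 1 • x = 0) (h : ∀ k, f (k + 1) • x = 0) : IsDefectFree q f x := by
  have key : ∀ {a : A} {c : A} (k : ℕ), a * f (k + 1) = q⁻¹ • (f (k + 1) * a) + c →
      a • x = 0 → c • x = 0 := by
    intro a c k hac ha
    have := congrArg (· • x) hac
    simpa [add_smul, mul_smul, h, ha] using this.symm
  have h1 : ∀ j, 1 ≤ j → epsDefect q f 0 j • x = 0 := by
    intro j hj
    induction j, hj using Nat.le_induction with
    | base => exact h0
    | succ j hj ih => exact key _ (hf.epsDefect_mul_right hj) ih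
  intro i
  induction i with
  | zero => exact h1
  | succ i ih => exact fun j hj => key _ (hf.epsDefect_mul_left hq hs hj) (ih j (by omega))

lemma isDefectFree_smul_succ (hf : IsSerreSeq q f) (hq : q ≠ 0) (hs : q + q⁻¹ ≠ 0) {x : N}
    (hx : IsDefectFree q f x) (k : ℕ) : IsDefectFree q f (f (k + 1) • x) := by
  intro i j hij
  rw [← mul_smul]
  by_cases hi : i = k
  · subst hi
    rcases Nat.eq_or_lt_of_le (Nat.succ_le_of_lt hij) with h | h
    · rw [← h, hf.epsDefect_mul_mid hq, mul_smul, hx _ _ (by omega), smul_zero]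
    · rw [hf.epsDefect_mul_left hq hs h, add_smul, smul_assoc, mul_smul, hx _ _ hij, hx _ _ h]
      simp
  by_cases hj : j = k
  · subst hj
    rw [hf.epsDefect_mul_right hij, add_smul, smul_assoc, mul_smul, hx _ _ hij,
      hx _ _ (by omega)]
    simp
  obtain ⟨c, hc⟩ := hf.epsDefect_mul_of_ne hq hs hi hj
  rw [hc, smul_assoc, mul_smul, hx _ _ hij, smul_zero, smul_zero]

lemma epsVec_smul_comm {x : N} {i j : ℕ} (h : epsDefect q f i j • x = 0) :
    epsVec q f j • epsVec q f i • x = q⁻¹ • epsVec q f i • epsVec q f j • x := by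
  rwa [epsDefect, qComm, sub_smul, smul_assoc, mul_smul, mul_smul, sub_eq_zero] at h

/-- No relation moves `f 0` past this defect directly. Instead, the vector is computed in two ways
as a multiple of `u = α • b • x`, and comparison gives `(q + q⁻¹ + q⁻³) u = 0`. -/
lemma epsDefect_one_two_smul (hf : IsSerreSeq q f) (hq : q ≠ 0) (hs : q + q⁻¹ ≠ 0)
    (hs3 : q + q⁻¹ + q⁻¹ ^ 3 ≠ 0) {x : N} (hx : IsDefectFree q f x) :
    epsDefect q f 1 2 • f 0 • x = 0 := by
  set b := epsVec q f 1 with hb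
  set c := epsVec q f 2 with hc
  set α := epsDefect q f 0 2 with hα
  set β := epsDefect q f 0 1 with hβ
  set D := epsDefect q f 1 2 with hD
  have hxk := hf.isDefectFree_smul_succ hq hs hx
  have hα0 : ∀ y : N, α • f 0 • y = f 0 • α • y := fun y => by
    rw [← mul_smul, ← hf.epsDefect_zero_comm hq (by norm_num), mul_smul]
  have hβ0 : ∀ y : N, β • f 0 • y = f 0 • β • y := fun y => by
    rw [← mul_smul, ← hf.epsDefect_zero_comm hq le_rfl, mul_smul]
  have hαx : α • x = 0 := hx 0 2 (by norm_num)
  have hβx : β • x = 0 := hx 0 1 (by norm_num)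
  have hDx : D • x = 0 := hx 1 2 (by norm_num)
  have hbdef : ∀ y : N, b • y = f 0 • f 1 • y - q⁻¹ • f 1 • f 0 • y := fun y => by
    rw [hb, epsVec, epsVec, qComm, sub_smul, smul_assoc, mul_smul, mul_smul]
  have hcdef : ∀ y : N, c • y = b • f 2 • y - q⁻¹ • f 2 • b • y := fun y => by
    rw [hc, epsVec, qComm, sub_smul, smul_assoc, mul_smul, mul_smul]
  have hDdef : ∀ y : N, D • y = c • b • y - q⁻¹ • b • c • y := fun y => by
    rw [hD, epsDefect, qComm, sub_smul, smul_assoc, mul_smul, mul_smul]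
  have hαdef : ∀ y : N, α • y = c • f 0 • y - q⁻¹ • f 0 • c • y := fun y => by
    rw [hα, epsDefect, qComm, sub_smul, smul_assoc, mul_smul, mul_smul]; rfl
  have hβdef : ∀ y : N, β • y = b • f 0 • y - q⁻¹ • f 0 • b • y := fun y => by
    rw [hβ, epsDefect, qComm, sub_smul, smul_assoc, mul_smul, mul_smul]; rfl
  have hα1 : ∀ y : N, α • f 1 • y = q⁻¹ • f 1 • α • y + D • y := fun y => by
    rw [← mul_smul, hf.epsDefect_mul_left hq hs (by norm_num), add_smul, smul_assoc, mul_smul]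
  have hβ2 : ∀ y : N, β • f 2 • y = q⁻¹ • f 2 • β • y + α • y := fun y => by
    rw [← mul_smul, hf.epsDefect_mul_right (by norm_num), add_smul, smul_assoc, mul_smul]
  have hβ1 : ∀ y : N, β • f 1 • y = f 1 • β • y := fun y => by
    rw [← mul_smul, hf.epsDefect_mul_mid hq, mul_smul]
  have comm_smul : ∀ (r : ℂ) (a : A) (y : N), a • r • y = r • a • y := fun r a y =>
    smul_algebra_smul_comm r a y
  have hβb : ∀ y : N, β • b • y = b • β • y := fun y => by
    rw [hbdef, hbdef, smul_sub, comm_smul, hβ0, hβ1, hβ1, hβ0]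
  -- First computation: `D` arises from moving `f 1` past `α`, and `α` commutes with `f 0`.
  have e1 : D • f 0 • x = -q • α • b • x := by
    have h1 := hα1 (f 0 • x)
    have h2 : f 1 • f 0 • x = q • f 0 • f 1 • x - q • b • x := by
      rw [hbdef, smul_sub q, smul_smul q, mul_inv_cancel₀ hq, one_smul, sub_sub_cancel]
    have h3 : α • f 1 • x = 0 := hxk 0 0 2 (by norm_num)
    rw [hα0, hαx, smul_zero, smul_zero, smul_zero, zero_add, h2, smul_sub, comm_smul, comm_smul,
      hα0, h3, smul_zero, smul_zero, zero_sub] at h1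
    rw [neg_smul, h1]
  have e2 : β • c • x = -q⁻¹ • α • b • x := by
    have h3 : β • f 2 • x = 0 := hxk 1 0 1 (by norm_num)
    rw [hcdef, smul_sub, comm_smul, hβb, h3, hβ2, hβb, hβx]
    simp
  -- Second computation: expand `D` and reorder `f 0` to the left; the leftover terms cancel because
  -- `D` kills `x`.
  have e3 : D • f 0 • x = q⁻¹ • α • b • x - (q⁻¹ * q⁻¹) • β • c • x := by
    have h1 : b • f 0 • x = q⁻¹ • f 0 • b • x := by
      have := hβdef x; rw [hβx] at this; exact (sub_eq_zero.1 this.symm)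
    have h2 : c • f 0 • x = q⁻¹ • f 0 • c • x := by
      have := hαdef x; rw [hαx] at this; exact (sub_eq_zero.1 this.symm)
    have h3 : c • b • x = q⁻¹ • b • c • x := by
      have := hDdef x; rw [hDx] at this; exact (sub_eq_zero.1 this.symm)
    have h4 := hαdef (b • x)
    have h5 := hβdef (c • x)
    rw [h3, comm_smul] at h4
    rw [hDdef, h1, h2, comm_smul, comm_smul, h4, h5]
    generalize c • f 0 • b • x = u₁, f 0 • b • c • x = u₂, b • f 0 • c • x = u₃
    module
  rw [e2, e1] at e3
  rw [e1]
  generalize α • b • x = u at e3 ⊢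
  have e4 : (q + q⁻¹ + q⁻¹ ^ 3) • u = 0 := by
    linear_combination (norm := module) -e3
  rw [(smul_eq_zero.1 e4).resolve_left hs3, smul_zero]

lemma isDefectFree_smul_zero (hf : IsSerreSeq q f) (hq : q ≠ 0) (hs : q + q⁻¹ ≠ 0)
    (hs3 : q + q⁻¹ + q⁻¹ ^ 3 ≠ 0) {x : N} (hx : IsDefectFree q f x) :
    IsDefectFree q f (f 0 • x) := by
  -- The premise ranges over all defect-free `y` because it is applied to `f (k + 1) • y` as well;
  -- `1 ≤ k` ensures that `f (k + 1)` commutes with `f 0`.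
  have key : ∀ {a c : A} (k : ℕ), 1 ≤ k → a * f (k + 1) = q⁻¹ • (f (k + 1) * a) + c →
      (∀ y : N, IsDefectFree q f y → a • f 0 • y = 0) →
      ∀ y : N, IsDefectFree q f y → c • f 0 • y = 0 := by
    intro a c k hk hac ha y hy
    have h1 := congrArg (· • f 0 • y) hac
    have h2 : f (k + 1) • f 0 • y = f 0 • f (k + 1) • y := by
      rw [← mul_smul, ← hf.comm 0 (k + 1) (by omega), mul_smul]
    simp only [add_smul, mul_smul, smul_assoc, h2, ha y hy,
      ha _ (hf.isDefectFree_smul_succ hq hs hy k), smul_zero, zero_add] at h1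
    exact h1.symm
  have h0 : ∀ j, 1 ≤ j → ∀ y : N, IsDefectFree q f y → epsDefect q f 0 j • f 0 • y = 0 := by
    intro j hj y hy
    rw [← mul_smul, ← hf.epsDefect_zero_comm hq hj, mul_smul, hy 0 j hj, smul_zero]
  have h1 : ∀ j, 2 ≤ j → ∀ y : N, IsDefectFree q f y → epsDefect q f 1 j • f 0 • y = 0 := by
    intro j hj
    induction j, hj using Nat.le_induction with
    | base => exact fun y hy => hf.epsDefect_one_two_smul hq hs hs3 hy
    | succ j hj ih => exact key j (by omega) (hf.epsDefect_mul_right hj) ih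
  have h2 : ∀ i j, i + 1 < j → ∀ y : N, IsDefectFree q f y →
      epsDefect q f (i + 1) j • f 0 • y = 0 := by
    intro i
    induction i with
    | zero => exact h1
    | succ i ih =>
      exact fun j hj => key (i + 1) (by omega) (hf.epsDefect_mul_left hq hs hj) (ih j (by omega))
  intro i j hij
  cases i with
  | zero => exact h0 j hij x hx
  | succ i => exact h2 i j hij x hx

lemma isDefectFree_smul (hf : IsSerreSeq q f) (hq : q ≠ 0) (hs : q + q⁻¹ ≠ 0)
    (hs3 : q + q⁻¹ + q⁻¹ ^ 3 ≠ 0) {x : N} (hx : IsDefectFree q f x) (k : ℕ) :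
    IsDefectFree q f (f k • x) := by
  cases k with
  | zero => exact hf.isDefectFree_smul_zero hq hs hs3 hx
  | succ k => exact hf.isDefectFree_smul_succ hq hs hx k

end IsSerreSeq

end DefectKernel

/-! ### Ordered monomials in root vectors that `q`-commute on a module -/

section Spanning

variable {A : Type*} [Ring A] [Algebra ℂ A] {N : Type*} [AddCommGroup N] [Module ℂ N] [Module A N]
  [IsScalarTower ℂ A N] {q : ℂ} {f : ℕ → A}

/-- The ordered monomial in the root vectors. -/
noncomputable def epsMonomial (q : ℂ) (f : ℕ → A) {n : ℕ} (m : Fin n → ℕ) : A :=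
  (List.ofFn fun i : Fin n => epsVec q f i ^ m i).prod

lemma epsMonomial_eq {n : ℕ} (m : Fin n → ℕ) : epsMonomial q f m =
    ((List.finRange n).map fun i : Fin n => epsVec q f i ^ m i).prod := by
  rw [epsMonomial, List.ofFn_eq_map]

/-- The span of the ordered monomials in the root vectors, applied to a vector. -/
noncomputable def epsSpan (q : ℂ) (f : ℕ → A) (n : ℕ) (x : N) : Submodule ℂ N :=
  Submodule.span ℂ (Set.range fun m : Fin n → ℕ => epsMonomial q f m • x)

lemma epsVec_smul_pow_smul (h : ∀ i j, i < j → ∀ y : N, epsDefect q f i j • y = 0) {i j : ℕ}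
    (hij : i < j) (p : ℕ) (y : N) : epsVec q f j • epsVec q f i ^ p • y =
      q⁻¹ ^ p • epsVec q f i ^ p • epsVec q f j • y := by
  induction p generalizing y with
  | zero => simp
  | succ p ih =>
    rw [pow_succ, mul_smul, ih, IsSerreSeq.epsVec_smul_comm (h i j hij y),
      smul_algebra_smul_comm, smul_smul (q⁻¹ ^ p), ← pow_succ,
      mul_smul (epsVec q f i ^ p)]

/-- The factor `f_{ε_j}` travels right past the smaller root vectors, collecting powers of `q⁻¹`,
until it joins its own power. -/
lemma epsVec_smul_list (h : ∀ i j, i < j → ∀ y : N, epsDefect q f i j • y = 0) {n : ℕ}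
    (m : Fin n → ℕ) (j : Fin n) (x : N) (L : List (Fin n)) (hL : L.Pairwise (· < ·))
    (hj : j ∈ L) :
    ∃ c : ℂ, epsVec q f j • (L.map fun i : Fin n => epsVec q f i ^ m i).prod • x =
      c • (L.map fun i : Fin n => epsVec q f i ^ (m i + if i = j then 1 else 0)).prod • x := by
  induction L with
  | nil => simp at hj
  | cons i L ih =>
    rw [List.pairwise_cons] at hL
    simp only [List.map_cons, List.prod_cons]
    by_cases hij : i = j
    · subst hij
      refine ⟨1, ?_⟩
      have : (L.map fun k : Fin n => epsVec q f k ^ (m k + if k = i then 1 else 0)) =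
          L.map fun k : Fin n => epsVec q f k ^ m k := by
        refine List.map_congr_left fun k hk => ?_
        simp [(hL.1 k hk).ne']
      rw [this, ← mul_smul, ← mul_assoc, ← pow_succ', one_smul]
      simp
    · have hjL : j ∈ L := by
        rcases List.mem_cons.1 hj with h' | h'
        · exact absurd h'.symm hij
        · exact h'
      obtain ⟨c, hc⟩ := ih hL.2 hjL
      refine ⟨q⁻¹ ^ m i * c, ?_⟩
      rw [mul_smul, epsVec_smul_pow_smul h (hL.1 j hjL), hc, smul_algebra_smul_comm,
        smul_smul (q⁻¹ ^ m i), mul_smul (epsVec q f i ^ _)]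
      simp [hij]

lemma epsVec_smul_mem (h : ∀ i j, i < j → ∀ y : N, epsDefect q f i j • y = 0) {n : ℕ}
    (x : N) (j : Fin n) {y : N} (hy : y ∈ epsSpan q f n x) :
    epsVec q f j • y ∈ epsSpan q f n x := by
  induction hy using Submodule.span_induction with
  | mem y hy =>
    obtain ⟨m, rfl⟩ := hy
    obtain ⟨c, hc⟩ := epsVec_smul_list h m j x (List.finRange n) (List.pairwise_lt_finRange n)
      (List.mem_finRange j)
    simp only [epsMonomial_eq]
    rw [hc, ← epsMonomial_eq (fun i => m i + if i = j then 1 else 0)]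
    exact Submodule.smul_mem _ _ (Submodule.subset_span ⟨_, rfl⟩)
  | zero => simp
  | add a b _ _ ha hb => rw [smul_add]; exact add_mem ha hb
  | smul r a _ ha => rw [smul_algebra_smul_comm]; exact Submodule.smul_mem _ _ ha

lemma mem_epsSpan_self (n : ℕ) (x : N) : x ∈ epsSpan q f n x :=
  Submodule.subset_span ⟨0, by simp [epsMonomial_eq]⟩

namespace IsSerreSeq

lemma exists_mul_epsVec (hf : IsSerreSeq q f) (hq : q ≠ 0) (hs : q + q⁻¹ ≠ 0) {i k : ℕ}
    (h1 : i ≠ k) : ∃ c : ℂ, f (k + 1) * epsVec q f i = c • (epsVec q f i * f (k + 1)) := by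
  by_cases h2 : i = k + 1
  · exact ⟨q⁻¹, by rw [h2, hf.epsVec_mul_self hq, smul_smul, inv_mul_cancel₀ hq, one_smul]⟩
  · exact ⟨1, by rw [one_smul, hf.epsVec_mul_of_ne hq hs h1 h2]⟩

lemma smul_mem_epsSpan (hf : IsSerreSeq q f) (hq : q ≠ 0) (hs : q + q⁻¹ ≠ 0)
    (h : ∀ i j, i < j → ∀ y : N, epsDefect q f i j • y = 0) {n : ℕ} (hn : 0 < n)
    (hfn : ∀ k, n ≤ k → f k = 0) {x : N} (hx : ∀ k, f (k + 1) • x = 0) (k : ℕ) {y : N}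
    (hy : y ∈ epsSpan q f n x) : f k • y ∈ epsSpan q f n x := by
  cases k with
  | zero => exact epsVec_smul_mem h x ⟨0, hn⟩ hy
  | succ k =>
    -- Acting by `a` must preserve membership of `z` and of `f (k + 1) • z` simultaneously: then the
    -- condition is multiplicative, and a monomial can be treated one root vector at a time.
    let S : Submonoid A :=
      { carrier := {a | ∀ z ∈ epsSpan q f n x, f (k + 1) • z ∈ epsSpan q f n x →
          a • z ∈ epsSpan q f n x ∧ f (k + 1) • a • z ∈ epsSpan q f n x}
        one_mem' := fun z hz hz' => by simpa using ⟨hz, hz'⟩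
        mul_mem' := fun {a b} ha hb z hz hz' => by
          rw [mul_smul]
          exact ha _ (hb z hz hz').1 (hb z hz hz').2 }
    have hS : ∀ i : Fin n, epsVec q f i ∈ S := by
      intro i z hz hz'
      refine ⟨epsVec_smul_mem h x i hz, ?_⟩
      by_cases hik : (i : ℕ) = k
      -- The one non-commuting case: `f_{k+1} f_{ε_k} = q (f_{ε_k} f_{k+1} - f_{ε_{k+1}})`. At the
      -- end of the diagram `f_{k+1} = 0`.
      · rcases Nat.lt_or_ge (k + 1) n with hk | hk
        · have h1 := congrArg (· • z) (epsVec_succ (q := q) (f := f) k)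
          simp only [mul_smul, add_smul, smul_assoc] at h1
          have h2 : f (k + 1) • epsVec q f k • z =
              q • (epsVec q f k • f (k + 1) • z - epsVec q f (k + 1) • z) := by
            rw [h1, add_sub_cancel_right, smul_smul q, mul_inv_cancel₀ hq, one_smul]
          rw [hik, h2, ← hik]
          refine Submodule.smul_mem _ _ (sub_mem (epsVec_smul_mem h x i ?_) ?_)
          · rwa [hik]
          · rw [hik]
            exact epsVec_smul_mem h x ⟨k + 1, hk⟩ hz
        · rw [hfn _ hk, zero_smul]
          exact zero_mem _
      · obtain ⟨c, hc⟩ := hf.exists_mul_epsVec hq hs hik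
        rw [← mul_smul, hc, smul_assoc, mul_smul]
        exact Submodule.smul_mem _ _ (epsVec_smul_mem h x i hz')
    induction hy using Submodule.span_induction with
    | mem y hy =>
      obtain ⟨m, rfl⟩ := hy
      have hm : epsMonomial q f m ∈ S := by
        rw [epsMonomial_eq]
        refine Submonoid.list_prod_mem _ fun a ha => ?_
        obtain ⟨i, -, rfl⟩ := List.mem_map.1 ha
        exact pow_mem (hS i) _
      exact (hm x (mem_epsSpan_self n x) (by rw [hx]; exact zero_mem _)).2
    | zero => simp
    | add a b _ _ ha hb => rw [smul_add]; exact add_mem ha hb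
    | smul r a _ ha => rw [smul_algebra_smul_comm]; exact Submodule.smul_mem _ _ ha

end IsSerreSeq

end Spanning

/-! ### Relations of the quantum group and of the base module in sequence form -/

section BaseModule

variable {n : ℕ} {q : ℂ}

lemma sum_simpleRoot_mul {R : Type*} [CommRing R] (i : Fin n) (g : Fin n → R) :
    ∑ k, g k * (simpleRoot n i k : R) =
      g i - if h : 0 < (i : ℕ) then g ⟨i - 1, by omega⟩ else 0 := by
  simp only [simpleRoot, Int.cast_sub, mul_sub, Finset.sum_sub_distrib, Int.cast_ite, Int.cast_one,
    Int.cast_zero, mul_ite, mul_one, mul_zero]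
  congr 1
  · simp [← Fin.ext_iff]
  · split_ifs with h
    · rw [Finset.sum_eq_single ⟨i - 1, by omega⟩]
      · rw [if_pos (by simp; omega)]
      · intro b _ hb
        rw [if_neg]
        intro hb'
        exact hb (Fin.ext (by simp; omega))
      · simp
    · exact Finset.sum_eq_zero fun k _ => by rw [if_neg (by omega)]

lemma rootForm_eq (i j : Fin n) : rootForm n i j =
    if (i : ℕ) = j then (if (i : ℕ) = 0 then 1 else 2)
    else if (i : ℕ) + 1 = j ∨ (j : ℕ) + 1 = i then -1 else 0 := by
  have h := sum_simpleRoot_mul j (simpleRoot n i)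
  simp only [Int.cast_id] at h
  rw [rootForm, h]
  simp only [simpleRoot]
  split_ifs <;> omega

/-- The generators `f_α` as a sequence, extended by zero. -/
noncomputable def uqFSeq (n : ℕ) (q : ℂ) (k : ℕ) : Uq n q :=
  if h : k < n then uqF n q ⟨k, h⟩ else 0

lemma uqFSeq_of_lt {k : ℕ} (h : k < n) : uqFSeq n q k = uqF n q ⟨k, h⟩ := dif_pos h

lemma uqFSeq_of_le {k : ℕ} (h : n ≤ k) : uqFSeq n q k = 0 := dif_neg (by omega)

lemma serrePoly_eq_qComm {A : Type*} [Ring A] [Algebra ℂ A] (hq : q ≠ 0) (x y : A) :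
    serrePoly q x y = qComm q⁻¹ x (qComm q x y) := by
  rw [qComm_expand, serrePoly, add_comm q⁻¹, inv_mul_cancel₀ hq, one_smul]

/-- Extension by zero makes every relation that reaches beyond the rank trivial, so no bounds on
indices are needed later. -/
lemma isSerreSeq_uqFSeq (hq : q ≠ 0) : IsSerreSeq q (uqFSeq n q) where
  comm i j hij := by
    rcases Nat.lt_or_ge j n with hj | hj
    · rw [uqFSeq_of_lt hj, uqFSeq_of_lt (show i < n by omega)]
      have := uq_comm_f (q := q) (⟨i, by omega⟩ : Fin n) ⟨j, hj⟩
        (by rw [rootForm_eq]; simp only; split_ifs <;> omega)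
      simpa [qComm, sub_eq_zero] using this
    · simp [uqFSeq_of_le hj]
  serre_up i := by
    rcases Nat.lt_or_ge (i + 2) n with hj | hj
    · rw [uqFSeq_of_lt hj, uqFSeq_of_lt (show i + 1 < n by omega), serrePoly_eq_qComm hq]
      exact uq_serre_f _ _ (by simp [rootForm_eq])
    · simp [uqFSeq_of_le hj, serrePoly]
  serre_down i := by
    rcases Nat.lt_or_ge (i + 1) n with hj | hj
    · rw [uqFSeq_of_lt hj, uqFSeq_of_lt (show i < n by omega), serrePoly_eq_qComm hq]
      exact uq_serre_f _ _ (by simp [rootForm_eq])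
    · simp [uqFSeq_of_le hj, serrePoly]
  short := by
    rcases Nat.lt_or_ge 1 n with hj | hj
    · rw [uqFSeq_of_lt hj, uqFSeq_of_lt (show 0 < n by omega), serrePoly_eq_qComm hq]
      have := uq_serre_short_f (q := q) (by omega) hj
      rw [qComm, one_smul, sub_eq_zero] at this
      exact this
    · simp [uqFSeq_of_le hj, serrePoly]

lemma uqFEps_eq_epsVec (k : ℕ) (h : k < n) : uqFEps n q k h = epsVec q (uqFSeq n q) k := by
  induction k with
  | zero => exact (uqFSeq_of_lt h).symm
  | succ k ih => rw [uqFEps, epsVec, ih, uqFSeq_of_lt h]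

lemma uqMonomial_eq_epsMonomial (m : Fin n → ℕ) :
    uqMonomial n q m = epsMonomial q (uqFSeq n q) m := by
  simp only [uqMonomial, epsMonomial, uqFEps_eq_epsVec]

lemma subalgebra_eq_top_of_gen (S : Subalgebra ℂ (Uq n q)) (h : ∀ x, uqGen n q x ∈ S) :
    S = ⊤ := by
  rw [eq_top_iff]
  rintro a -
  obtain ⟨b, rfl⟩ := RingQuot.mkAlgHom_surjective ℂ (UqRel n q) a
  induction b using FreeAlgebra.induction with
  | grade0 r => rw [AlgHom.commutes]; exact S.algebraMap_mem r
  | grade1 x => exact h x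
  | mul a b ha hb => rw [map_mul]; exact S.mul_mem ha hb
  | add a b ha hb => rw [map_add]; exact S.add_mem ha hb

variable {ħ : ℂ} {wt : Fin n → ℂ}

lemma exists_smul_baseVec (x : BaseModule n q ħ wt) : ∃ a : Uq n q, x = a • baseVec n q ħ wt := by
  obtain ⟨y, rfl⟩ := Submodule.Quotient.mk_surjective _ x
  obtain ⟨a, rfl⟩ := Submodule.Quotient.mk_surjective _ y
  refine ⟨a, ?_⟩
  rw [baseVec, vermaVec, ← Submodule.Quotient.mk_smul, ← Submodule.Quotient.mk_smul, smul_eq_mul,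
    mul_one]

lemma uqE_smul_vermaVec (i : Fin n) : uqE n q i • vermaVec n q ħ wt = 0 := by
  rw [vermaVec, ← Submodule.Quotient.mk_smul, smul_eq_mul, mul_one, Submodule.Quotient.mk_eq_zero]
  exact Submodule.subset_span (Or.inl ⟨i, rfl⟩)

lemma uqK_smul_vermaVec (i : Fin n) : uqK n q i • vermaVec n q ħ wt =
    Complex.exp (ħ * weightRoot wt i) • vermaVec n q ħ wt := by
  rw [← sub_eq_zero, ← algebraMap_smul (Uq n q) (Complex.exp (ħ * weightRoot wt i)), ← sub_smul,
    vermaVec, ← Submodule.Quotient.mk_smul, smul_eq_mul, mul_one, Submodule.Quotient.mk_eq_zero]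
  exact Submodule.subset_span (Or.inr ⟨i, rfl⟩)

lemma uqE_smul_baseVec (i : Fin n) : uqE n q i • baseVec n q ħ wt = 0 := by
  rw [baseVec, ← Submodule.Quotient.mk_smul, uqE_smul_vermaVec, Submodule.Quotient.mk_zero]

lemma uqK_smul_baseVec (i : Fin n) : uqK n q i • baseVec n q ħ wt =
    Complex.exp (ħ * weightRoot wt i) • baseVec n q ħ wt := by
  rw [baseVec, ← Submodule.Quotient.mk_smul, uqK_smul_vermaVec, Submodule.Quotient.mk_smul]

lemma uqFSeq_smul_baseVec (k : ℕ) : uqFSeq n q (k + 1) • baseVec n q ħ wt = 0 := by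
  rcases Nat.lt_or_ge (k + 1) n with hk | hk
  · rw [uqFSeq_of_lt hk, baseVec, ← Submodule.Quotient.mk_smul, Submodule.Quotient.mk_eq_zero]
    exact Submodule.subset_span (Or.inl ⟨_, Nat.succ_pos k, rfl⟩)
  · rw [uqFSeq_of_le hk, zero_smul]

lemma epsDefect_smul_baseVec (hq : q ≠ 0) :
    epsDefect q (uqFSeq n q) 0 1 • baseVec n q ħ wt = 0 := by
  rw [IsSerreSeq.epsDefect_zero_one hq, smul_assoc, serrePoly_eq_qComm hq]
  rcases Nat.lt_or_ge 1 n with hn | hn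
  · rw [uqFSeq_of_lt hn, uqFSeq_of_lt (show 0 < n by omega), baseVec,
      ← Submodule.Quotient.mk_smul, (Submodule.Quotient.mk_eq_zero _).2, smul_zero]
    exact Submodule.subset_span (Or.inr ⟨_, _, rfl⟩)
  · simp [uqFSeq_of_le hn, qComm]

end BaseModule

/-! ### The base module is spanned by words, then by ordered monomials -/

section WordSpan

variable {n : ℕ} {q ħ : ℂ} {wt : Fin n → ℂ}

/-- The span of the words in the `f_α`, applied to the canonical generator. -/
noncomputable def wordSpan (n : ℕ) (q ħ : ℂ) (wt : Fin n → ℂ) :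
    Submodule ℂ (BaseModule n q ħ wt) :=
  Submodule.span ℂ ((fun w : Uq n q => w • baseVec n q ħ wt) ''
    (Submonoid.closure (Set.range (uqF n q)) : Set (Uq n q)))

lemma smul_mem_wordSpan_of_words {a : Uq n q}
    (h : ∀ w ∈ Submonoid.closure (Set.range (uqF n q)),
      a • w • baseVec n q ħ wt ∈ wordSpan n q ħ wt)
    {y : BaseModule n q ħ wt} (hy : y ∈ wordSpan n q ħ wt) : a • y ∈ wordSpan n q ħ wt := by
  induction hy using Submodule.span_induction with
  | mem y hy =>
    obtain ⟨w, hw, rfl⟩ := hy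
    exact h w hw
  | zero => simp
  | add a b _ _ ha hb => rw [smul_add]; exact add_mem ha hb
  | smul r a _ ha => rw [smul_algebra_smul_comm]; exact Submodule.smul_mem _ _ ha

lemma word_mem_wordSpan {w : Uq n q} (hw : w ∈ Submonoid.closure (Set.range (uqF n q))) :
    w • baseVec n q ħ wt ∈ wordSpan n q ħ wt :=
  Submodule.subset_span ⟨w, hw, rfl⟩

lemma uqF_smul_mem_wordSpan (i : Fin n) {y : BaseModule n q ħ wt} (hy : y ∈ wordSpan n q ħ wt) :
    uqF n q i • y ∈ wordSpan n q ħ wt := by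
  refine smul_mem_wordSpan_of_words (fun w hw => ?_) hy
  rw [← mul_smul]
  exact word_mem_wordSpan (mul_mem (Submonoid.subset_closure ⟨i, rfl⟩) hw)

lemma uqKinv_smul_baseVec (i : Fin n) : uqKinv n q i • baseVec n q ħ wt =
    (Complex.exp (ħ * weightRoot wt i))⁻¹ • baseVec n q ħ wt := by
  have h := congrArg (uqKinv n q i • ·) (uqK_smul_baseVec (q := q) (ħ := ħ) (wt := wt) i)
  simp only [← mul_smul, uq_kinv_k, one_smul, smul_algebra_smul_comm] at h
  rw [eq_inv_smul_iff₀ (Complex.exp_ne_zero _), ← h]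

lemma smul_mem_wordSpan_of_eigen {a : Uq n q}
    (h1 : ∃ c : ℂ, a • baseVec n q ħ wt = c • baseVec n q ħ wt)
    (h2 : ∀ j, ∃ c : ℂ, a * uqF n q j = c • (uqF n q j * a))
    {y : BaseModule n q ħ wt} (hy : y ∈ wordSpan n q ħ wt) : a • y ∈ wordSpan n q ħ wt := by
  refine smul_mem_wordSpan_of_words (fun w hw => ?_) hy
  induction hw using Submonoid.closure_induction_left with
  | one =>
    obtain ⟨c, hc⟩ := h1
    rw [one_smul, hc, ← one_smul (Uq n q) (baseVec n q ħ wt)]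
    exact Submodule.smul_mem _ _ (word_mem_wordSpan (one_mem _))
  | mul_left x hx w hw ih =>
    obtain ⟨j, rfl⟩ := hx
    obtain ⟨c, hc⟩ := h2 j
    rw [← mul_smul, ← mul_assoc, hc, smul_mul_assoc, smul_assoc, mul_assoc, mul_smul, mul_smul]
    exact Submodule.smul_mem _ _ (uqF_smul_mem_wordSpan j ih)

lemma uqK_smul_mem_wordSpan (i : Fin n) {y : BaseModule n q ħ wt} (hy : y ∈ wordSpan n q ħ wt) :
    uqK n q i • y ∈ wordSpan n q ħ wt :=
  smul_mem_wordSpan_of_eigen ⟨_, uqK_smul_baseVec i⟩ (fun j => ⟨_, uq_k_f i j⟩) hy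

lemma uqKinv_smul_mem_wordSpan (hq : q ≠ 0) (i : Fin n) {y : BaseModule n q ħ wt}
    (hy : y ∈ wordSpan n q ħ wt) : uqKinv n q i • y ∈ wordSpan n q ħ wt :=
  smul_mem_wordSpan_of_eigen ⟨_, uqKinv_smul_baseVec i⟩
    (fun j => ⟨_, uq_kinv_comm i _ _ (zpow_ne_zero _ hq) (uq_k_f i j)⟩) hy

/-- Moving `e_{α_i}` to the right through a word leaves only Cartan terms on shorter words, and
`e_{α_i}` kills `1_λ`. -/
lemma uqE_smul_mem_wordSpan (hq : q ≠ 0) (i : Fin n) {y : BaseModule n q ħ wt}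
    (hy : y ∈ wordSpan n q ħ wt) : uqE n q i • y ∈ wordSpan n q ħ wt := by
  refine smul_mem_wordSpan_of_words (fun w hw => ?_) hy
  induction hw using Submonoid.closure_induction_left with
  | one => rw [one_smul, uqE_smul_baseVec]; exact zero_mem _
  | mul_left x hx w hw ih =>
    obtain ⟨j, rfl⟩ := hx
    have h1 := uqF_smul_mem_wordSpan j ih
    rw [← mul_smul, ← mul_assoc]
    by_cases hij : i = j
    · subst hij
      rw [sub_eq_iff_eq_add.1 (uq_e_f_same i), add_mul, add_smul, smul_mul_assoc, smul_assoc,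
        sub_mul, sub_smul, mul_smul, mul_smul, mul_assoc, mul_smul, mul_smul]
      have hw' := word_mem_wordSpan (ħ := ħ) (wt := wt) hw
      exact add_mem (Submodule.smul_mem _ _ (sub_mem (uqK_smul_mem_wordSpan i hw')
        (uqKinv_smul_mem_wordSpan hq i hw'))) h1
    · rwa [uq_e_f_ne i j hij, mul_assoc, mul_smul, mul_smul]

lemma wordSpan_eq_top (hq : q ≠ 0) : wordSpan n q ħ wt = ⊤ := by
  let S : Subalgebra ℂ (Uq n q) :=
    { carrier := {a | ∀ y ∈ wordSpan n q ħ wt, a • y ∈ wordSpan n q ħ wt}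
      mul_mem' := fun {a b} ha hb y hy => by rw [mul_smul]; exact ha _ (hb y hy)
      add_mem' := fun {a b} ha hb y hy => by rw [add_smul]; exact add_mem (ha y hy) (hb y hy)
      algebraMap_mem' := fun r y hy => by
        rw [algebraMap_smul]; exact Submodule.smul_mem _ _ hy }
  have hS : S = ⊤ := subalgebra_eq_top_of_gen S fun x y hy => by
    cases x with
    | e i => exact uqE_smul_mem_wordSpan hq i hy
    | f i => exact uqF_smul_mem_wordSpan i hy
    | k i => exact uqK_smul_mem_wordSpan i hy
    | kinv i => exact uqKinv_smul_mem_wordSpan hq i hy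
  rw [eq_top_iff]
  rintro x -
  obtain ⟨a, rfl⟩ := exists_smul_baseVec x
  have ha : a ∈ S := hS ▸ Algebra.mem_top
  refine ha _ ?_
  rw [← one_smul (Uq n q) (baseVec n q ħ wt)]
  exact word_mem_wordSpan (one_mem _)

/-- The induction principle behind the vanishing of the defects, the spanning by ordered monomials
and the uniqueness of the form. -/
lemma words_induction (hq : q ≠ 0) (S : Submodule ℂ (BaseModule n q ħ wt))
    (h1 : baseVec n q ħ wt ∈ S) (hf : ∀ i, ∀ x ∈ S, uqF n q i • x ∈ S) : S = ⊤ := by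
  rw [eq_top_iff, ← wordSpan_eq_top hq]
  refine Submodule.span_le.2 ?_
  rintro _ ⟨w, hw, rfl⟩
  simp only
  induction hw using Submonoid.closure_induction_left with
  | one => simpa using h1
  | mul_left x hx w hw ih =>
    obtain ⟨j, rfl⟩ := hx
    rw [mul_smul]
    exact hf _ _ ih

lemma add_inv_ne_zero (hq : q ≠ 0) (hroot : ∀ k : ℕ, 0 < k → q ^ k ≠ 1) : q + q⁻¹ ≠ 0 := by
  intro h
  have h2 : q ^ 2 = -1 := by
    field_simp at h
    linear_combination h
  exact hroot 4 (by norm_num) (by linear_combination (q ^ 2 - 1) * h2)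

lemma add_inv_add_inv_cube_ne_zero (hq : q ≠ 0) (hroot : ∀ k : ℕ, 0 < k → q ^ k ≠ 1) :
    q + q⁻¹ + q⁻¹ ^ 3 ≠ 0 := by
  intro h
  have h2 : q ^ 4 + q ^ 2 + 1 = 0 := by
    field_simp at h
    linear_combination h
  exact hroot 6 (by norm_num) (by linear_combination (q ^ 2 - 1) * h2)

lemma epsDefect_smul_eq_zero (hq : q ≠ 0) (hroot : ∀ k : ℕ, 0 < k → q ^ k ≠ 1) (i j : ℕ)
    (hij : i < j) (x : BaseModule n q ħ wt) : epsDefect q (uqFSeq n q) i j • x = 0 := by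
  have hf := isSerreSeq_uqFSeq (n := n) hq
  have hs := add_inv_ne_zero hq hroot
  let S : Submodule ℂ (BaseModule n q ħ wt) :=
    { carrier := {x | IsDefectFree q (uqFSeq n q) x}
      add_mem' := fun ha hb i j hij => by rw [smul_add, ha i j hij, hb i j hij, add_zero]
      zero_mem' := fun i j _ => smul_zero _
      smul_mem' := fun c x hx i j hij => by
        rw [smul_algebra_smul_comm, hx i j hij, smul_zero] }
  have hS : S = ⊤ := by
    refine words_induction hq S ?_ fun i x hx => ?_
    · exact hf.isDefectFree_of_killed hq hs (epsDefect_smul_baseVec hq) uqFSeq_smul_baseVec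
    · have := hf.isDefectFree_smul hq hs (add_inv_add_inv_cube_ne_zero hq hroot) hx i
      rwa [uqFSeq_of_lt i.isLt] at this
  have hx : x ∈ S := hS ▸ Submodule.mem_top
  exact hx i j hij

lemma span_uqMonomial_eq_top (hn : 0 < n) (hq : q ≠ 0) (hroot : ∀ k : ℕ, 0 < k → q ^ k ≠ 1) :
    Submodule.span ℂ (Set.range fun m : Fin n → ℕ => uqMonomial n q m • baseVec n q ħ wt) = ⊤ := by
  simp only [uqMonomial_eq_epsMonomial]
  refine words_induction hq (epsSpan q (uqFSeq n q) n (baseVec n q ħ wt)) (mem_epsSpan_self _ _)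
    fun i x hx => ?_
  have := (isSerreSeq_uqFSeq (n := n) hq).smul_mem_epsSpan hq (add_inv_ne_zero hq hroot)
    (epsDefect_smul_eq_zero hq hroot) hn (fun k hk => uqFSeq_of_le hk) uqFSeq_smul_baseVec i hx
  rwa [uqFSeq_of_lt i.isLt] at this

end WordSpan

/-! ### Weighted shifts on a lattice -/

section ShiftOperators

variable {ι : Type*}

/-- The weighted shift `x_m ↦ a(m) x_{m + d}`. -/
noncomputable def shiftOp (a : (ι → ℤ) → ℂ) (d : ι → ℤ) :
    Module.End ℂ ((ι → ℤ) →₀ ℂ) :=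
  Finsupp.linearCombination ℂ fun m => Finsupp.single (m + d) (a m)

lemma shiftOp_single (a : (ι → ℤ) → ℂ) (d m : ι → ℤ) (c : ℂ) :
    shiftOp a d (Finsupp.single m c) = Finsupp.single (m + d) (c * a m) := by
  simp [shiftOp]

lemma shiftOp_mul (a b : (ι → ℤ) → ℂ) (d e : ι → ℤ) :
    shiftOp a d * shiftOp b e = shiftOp (fun m => a (m + e) * b m) (d + e) := by
  refine Finsupp.lhom_ext fun m c => ?_
  rw [Module.End.mul_apply, shiftOp_single, shiftOp_single, shiftOp_single, add_assoc, add_comm e]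
  congr 1
  ring

lemma shiftOp_sub (a b : (ι → ℤ) → ℂ) (d : ι → ℤ) :
    shiftOp a d - shiftOp b d = shiftOp (fun m => a m - b m) d := by
  refine Finsupp.lhom_ext fun m c => ?_
  simp only [LinearMap.sub_apply, shiftOp_single, ← Finsupp.single_sub, mul_sub]

lemma shiftOp_smul (r : ℂ) (a : (ι → ℤ) → ℂ) (d : ι → ℤ) :
    r • shiftOp a d = shiftOp (fun m => r * a m) d := by
  refine Finsupp.lhom_ext fun m c => ?_
  simp only [LinearMap.smul_apply, shiftOp_single, Finsupp.smul_single, smul_eq_mul]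
  congr 1
  ring

lemma shiftOp_one : shiftOp (fun _ : ι → ℤ => 1) 0 = 1 := by
  refine Finsupp.lhom_ext fun m c => ?_
  simp [shiftOp_single]

lemma shiftOp_commute {a b : (ι → ℤ) → ℂ} {d e : ι → ℤ}
    (h : ∀ m, a (m + e) * b m = b (m + d) * a m) :
    shiftOp a d * shiftOp b e = shiftOp b e * shiftOp a d := by
  rw [shiftOp_mul, shiftOp_mul, add_comm d]
  congr 1
  exact funext h

/-- All three terms translate by the same vector, so the operator identity is a scalar recurrence at
each lattice point. -/
lemma serrePoly_shiftOp {q : ℂ} {a b : (ι → ℤ) → ℂ} {d e : ι → ℤ}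
    (h : ∀ m, a (m + e + d) * a (m + e) * b m - (q + q⁻¹) * (a (m + d + e) * b (m + d) * a m) +
      b (m + d + d) * a (m + d) * a m = 0) :
    serrePoly q (shiftOp a d) (shiftOp b e) = 0 := by
  refine Finsupp.lhom_ext fun m c => ?_
  have e1 : m + e + d + d = m + d + d + e := by abel
  have e2 : m + d + e + d = m + d + d + e := by abel
  simp only [serrePoly, LinearMap.add_apply, LinearMap.sub_apply, LinearMap.smul_apply,
    Module.End.mul_apply, shiftOp_single, e1, e2, Finsupp.smul_single, ← Finsupp.single_sub,
    ← Finsupp.single_add, LinearMap.zero_apply, smul_eq_mul]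
  rw [Finsupp.single_eq_zero]
  linear_combination c * h m

lemma shiftOp_pow_single (a : (ι → ℤ) → ℂ) (d m : ι → ℤ) (p : ℕ) (c : ℂ) :
    (shiftOp a d ^ p) (Finsupp.single m c) =
      Finsupp.single (m + p • d) (c * ∏ t ∈ Finset.range p, a (m + t • d)) := by
  induction p with
  | zero => simp
  | succ p ih =>
    rw [pow_succ', Module.End.mul_apply, ih, shiftOp_single, Finset.prod_range_succ, succ_nsmul,
      add_assoc, mul_assoc]

end ShiftOperators

/-! ### The Fock representation -/

section FockModule

variable {n : ℕ} {q : ℂ}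

/-- The symmetric `q`-number. -/
noncomputable def qnum (q : ℂ) (k : ℤ) : ℂ := (q ^ k - q ^ (-k)) / (q - q⁻¹)

lemma qnum_zero : qnum q 0 = 0 := by simp [qnum]

/-- This three-term recurrence is the source of every Serre relation on the Fock module. -/
lemma qnum_rec (hq : q ≠ 0) (k : ℤ) :
    qnum q k - (q + q⁻¹) * qnum q (k + 1) + qnum q (k + 1 + 1) = 0 := by
  simp only [qnum, neg_add, zpow_add₀ hq, zpow_one, zpow_neg]
  field_simp
  ring

lemma qnum_eq_zero (hq : q ≠ 0) (hroot : ∀ k : ℕ, 0 < k → q ^ k ≠ 1) (hd : q - q⁻¹ ≠ 0) {k : ℤ} :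
    qnum q k = 0 ↔ k = 0 := by
  refine ⟨fun h => ?_, fun h => by rw [h, qnum_zero]⟩
  by_contra hk
  rw [qnum, div_eq_zero_iff, or_iff_left hd, sub_eq_zero] at h
  have h2 : q ^ (2 * k) = 1 := by
    rw [two_mul, zpow_add₀ hq]
    nth_rw 1 [h]
    rw [← zpow_add₀ hq, neg_add_cancel, zpow_zero]
  rcases Int.natAbs_eq (2 * k) with h3 | h3
  · rw [h3, zpow_natCast] at h2
    exact hroot _ (by omega) h2
  · rw [h3, zpow_neg, zpow_natCast, inv_eq_one] at h2
    exact hroot _ (by omega) h2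

lemma simpleRoot_self (i : Fin n) : simpleRoot n i i = 1 := by simp [simpleRoot]

lemma simpleRoot_pred {i j : Fin n} (h : (j : ℕ) + 1 = i) : simpleRoot n i j = -1 := by
  simp only [simpleRoot]; split_ifs <;> omega

lemma simpleRoot_of_ne {i j : Fin n} (h1 : (j : ℕ) ≠ i) (h2 : (j : ℕ) + 1 ≠ i) :
    simpleRoot n i j = 0 := by
  simp only [simpleRoot]; split_ifs <;> omega

/-- The coefficient of the action of `f_α` on the Fock module. -/
noncomputable def fockF (q : ℂ) (i : Fin n) (m : Fin n → ℤ) : ℂ :=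
  if h : 0 < (i : ℕ) then qnum q (m ⟨i - 1, by omega⟩) else 1

/-- The coefficient of the action of `e_α` on the Fock module. -/
noncomputable def fockE (q γ : ℂ) (i : Fin n) (m : Fin n → ℤ) : ℂ :=
  (if 0 < (i : ℕ) then 1 else γ) * qnum q (m i)

/-- The pairing of a simple root with an integral weight. -/
def rootPairing (i : Fin n) (m : Fin n → ℤ) : ℤ := ∑ k, m k * simpleRoot n i k

/-- The eigenvalue of `q^{h_α}` on the Fock module. -/
noncomputable def fockK (q : ℂ) (κ : Fin n → ℂ) (i : Fin n) (m : Fin n → ℤ) : ℂ :=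
  κ i * q ^ (-rootPairing i m)

lemma fockF_of_pred {i j : Fin n} (h : (j : ℕ) + 1 = i) (m : Fin n → ℤ) :
    fockF q i m = qnum q (m j) := by
  rw [fockF, dif_pos (by omega)]
  congr 2
  exact Fin.ext (by simp; omega)

lemma fockF_of_zero {i : Fin n} (h : (i : ℕ) = 0) (m : Fin n → ℤ) : fockF q i m = 1 := by
  rw [fockF, dif_neg (by omega)]

lemma exists_pred {i : Fin n} (h : (i : ℕ) ≠ 0) : ∃ j : Fin n, (j : ℕ) + 1 = i :=
  ⟨⟨i - 1, by omega⟩, by simp; omega⟩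

lemma fockF_add_of_ne {i j : Fin n} (h1 : i ≠ j) (h2 : (j : ℕ) + 1 ≠ i) (m : Fin n → ℤ) :
    fockF q i (m + simpleRoot n j) = fockF q i m := by
  by_cases hi : (i : ℕ) = 0
  · rw [fockF_of_zero hi, fockF_of_zero hi]
  · obtain ⟨k, hk⟩ := exists_pred hi
    rw [fockF_of_pred hk, fockF_of_pred hk, Pi.add_apply,
      simpleRoot_of_ne (by omega) (by rw [hk]; exact fun h => h1 (Fin.ext h)), add_zero]

lemma fockF_sub_of_ne {i j : Fin n} (h1 : i ≠ j) (h2 : (j : ℕ) + 1 ≠ i) (m : Fin n → ℤ) :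
    fockF q i (m + -simpleRoot n j) = fockF q i m := by
  rw [← fockF_add_of_ne h1 h2 (m + -simpleRoot n j), neg_add_cancel_right]

lemma fockE_add_of_ne {γ : ℂ} {i j : Fin n} (h1 : i ≠ j) (h2 : (i : ℕ) + 1 ≠ j) (m : Fin n → ℤ) :
    fockE q γ i (m + simpleRoot n j) = fockE q γ i m := by
  rw [fockE, fockE, Pi.add_apply, simpleRoot_of_ne (fun h => h1 (Fin.ext h)) h2, add_zero]

lemma fockE_sub_of_ne {γ : ℂ} {i j : Fin n} (h1 : i ≠ j) (h2 : (i : ℕ) + 1 ≠ j) (m : Fin n → ℤ) :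
    fockE q γ i (m + -simpleRoot n j) = fockE q γ i m := by
  rw [← fockE_add_of_ne h1 h2 (m + -simpleRoot n j), neg_add_cancel_right]

lemma rootPairing_add (i : Fin n) (m m' : Fin n → ℤ) :
    rootPairing i (m + m') = rootPairing i m + rootPairing i m' := by
  simp [rootPairing, add_mul, Finset.sum_add_distrib]

lemma rootPairing_neg (i : Fin n) (m : Fin n → ℤ) :
    rootPairing i (-m) = -rootPairing i m := by
  simp [rootPairing]

lemma rootPairing_simpleRoot (i j : Fin n) : rootPairing i (simpleRoot n j) = rootForm n i j := by
  simp [rootPairing, rootForm, mul_comm]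

lemma rootPairing_of_zero {i : Fin n} (h : (i : ℕ) = 0) (m : Fin n → ℤ) :
    rootPairing i m = m i := by
  have := sum_simpleRoot_mul i m
  rw [dif_neg (by omega), sub_zero] at this
  exact this

lemma rootPairing_of_pred {i j : Fin n} (h : (j : ℕ) + 1 = i) (m : Fin n → ℤ) :
    rootPairing i m = m i - m j := by
  have := sum_simpleRoot_mul i m
  rw [dif_pos (by omega)] at this
  refine this.trans ?_
  congr 2
  exact Fin.ext (by simp; omega)

/-- The operators of the generators on the Fock module. -/
noncomputable def fockGen (q γ : ℂ) (κ : Fin n → ℂ) :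
    UqGen n → Module.End ℂ ((Fin n → ℤ) →₀ ℂ)
  | UqGen.e i => shiftOp (fockE q γ i) (-simpleRoot n i)
  | UqGen.f i => shiftOp (fockF q i) (simpleRoot n i)
  | UqGen.k i => shiftOp (fockK q κ i) 0
  | UqGen.kinv i => shiftOp (fun m => (fockK q κ i m)⁻¹) 0

lemma fock_serre_f (hq : q ≠ 0) {i j : Fin n} (h : 2 * rootForm n i j = -rootForm n i i) :
    serrePoly q (shiftOp (fockF q i) (simpleRoot n i)) (shiftOp (fockF q j) (simpleRoot n j)) =
      0 := by
  refine serrePoly_shiftOp fun m => ?_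
  -- The short root has square length `1`, which is odd, so the hypothesis excludes it.
  have hi : (i : ℕ) ≠ 0 := by
    intro hi; simp only [rootForm_eq] at h; split_ifs at h <;> omega
  obtain ⟨k, hk⟩ := exists_pred hi
  by_cases hij : (i : ℕ) + 1 = j
  · simp only [fockF_of_pred hk, fockF_of_pred hij, Pi.add_apply, simpleRoot_self,
      simpleRoot_pred hk, simpleRoot_of_ne (i := j) (j := k) (by omega) (by omega), add_zero]
    linear_combination qnum q (m k) * qnum q (m k + -1) * qnum_rec hq (m i)
  · have hji : (j : ℕ) + 1 = i := by
      simp only [rootForm_eq] at h; split_ifs at h <;> omega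
    obtain rfl : k = j := Fin.ext (by omega)
    have hne : k ≠ i := fun h => by subst h; omega
    simp only [fockF_add_of_ne hne hij, fockF_of_pred hk, Pi.add_apply, simpleRoot_self,
      simpleRoot_pred hk]
    have h1 := qnum_rec hq (m k + -1)
    rw [neg_add_cancel_right] at h1
    rw [add_right_comm (m k), neg_add_cancel_right]
    linear_combination qnum q (m k) * fockF q k m * h1

/-- The quadratic relation for the short root holds on the whole Fock module. It implies the cubic
relation of the algebra and is also what lets the map from the Verma module descend to `M`. -/
lemma fock_serre_short_f (hq : q ≠ 0) {i j : Fin n} (hi : (i : ℕ) = 0) (hij : (i : ℕ) + 1 = j) :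
    serrePoly q (shiftOp (fockF q i) (simpleRoot n i)) (shiftOp (fockF q j) (simpleRoot n j)) =
      0 := by
  refine serrePoly_shiftOp fun m => ?_
  simp only [fockF_of_zero hi, fockF_of_pred hij, Pi.add_apply, simpleRoot_self]
  linear_combination qnum_rec hq (m i)

lemma fock_serre_e (hq : q ≠ 0) (γ : ℂ) {i j : Fin n} (h : (i : ℕ) + 1 = j ∨ (j : ℕ) + 1 = i) :
    serrePoly q (shiftOp (fockE q γ i) (-simpleRoot n i))
      (shiftOp (fockE q γ j) (-simpleRoot n j)) = 0 := by
  refine serrePoly_shiftOp fun m => ?_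
  rcases h with h | h
  · have hne : j ≠ i := fun h => by subst h; omega
    simp only [fockE_sub_of_ne (γ := γ) (q := q) hne (by omega)]
    simp only [fockE, Pi.add_apply, Pi.neg_apply, simpleRoot_self, simpleRoot_pred h, neg_neg]
    have h1 := qnum_rec hq (m i + -1)
    rw [neg_add_cancel_right] at h1
    rw [add_right_comm (m i), neg_add_cancel_right]
    linear_combination qnum q (m i) * qnum q (m j) * (if 0 < (i : ℕ) then 1 else γ) ^ 2 *
      (if 0 < (j : ℕ) then 1 else γ) * h1
  · have hne : i ≠ j := fun h => by subst h; omega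
    simp only [fockE_sub_of_ne (γ := γ) (q := q) hne (by omega)]
    simp only [fockE, Pi.add_apply, Pi.neg_apply, simpleRoot_self, simpleRoot_pred h, neg_neg,
      simpleRoot_of_ne (i := j) (j := i) (by omega) (by omega), neg_zero, add_zero]
    linear_combination qnum q (m i) * qnum q (m i + -1) * (if 0 < (i : ℕ) then 1 else γ) ^ 2 *
      (if 0 < (j : ℕ) then 1 else γ) * qnum_rec hq (m j)

lemma fockK_add (hq : q ≠ 0) (κ : Fin n → ℂ) (i j : Fin n) (m : Fin n → ℤ) :
    fockK q κ i (m + simpleRoot n j) = q ^ (-rootForm n i j) * fockK q κ i m := by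
  rw [fockK, fockK, rootPairing_add, rootPairing_simpleRoot, neg_add, zpow_add₀ hq]
  ring

lemma fockK_sub (hq : q ≠ 0) (κ : Fin n → ℂ) (i j : Fin n) (m : Fin n → ℤ) :
    fockK q κ i (m + -simpleRoot n j) = q ^ rootForm n i j * fockK q κ i m := by
  rw [fockK, fockK, rootPairing_add, rootPairing_neg, rootPairing_simpleRoot, neg_add, neg_neg,
    zpow_add₀ hq]
  ring

/-- For a long root this is `[a + 1][b] - [b + 1][a] = [b - a]`. For the short root `[a + 1] - [a]`
is proportional to `q^a + q^{-a-1}`, whose plus sign matches the Cartan term because `κ² = -q⁻¹`;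
this also fixes `γ = κ q / (q - 1)`. -/
lemma fock_e_f_same (hq : q ≠ 0) (hq1 : q ≠ 1) (hd : q - q⁻¹ ≠ 0) {κ : Fin n → ℂ} {γ : ℂ}
    (hκ : ∀ i : Fin n, 0 < (i : ℕ) → κ i = 1)
    (hκ0 : ∀ i : Fin n, (i : ℕ) = 0 → κ i ^ 2 = -q⁻¹ ∧ γ = κ i * q / (q - 1))
    (i : Fin n) (m : Fin n → ℤ) :
    fockE q γ i (m + simpleRoot n i) * fockF q i m -
      fockF q i (m + -simpleRoot n i) * fockE q γ i m =
      (q - q⁻¹)⁻¹ * (fockK q κ i m - (fockK q κ i m)⁻¹) := by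
  by_cases hi : (i : ℕ) = 0
  · obtain ⟨h1, h2⟩ := hκ0 i hi
    have hne : κ i ≠ 0 := by
      rintro h; rw [h] at h1; simp [hq] at h1
    have h3 : (κ i)⁻¹ = -q * κ i := by
      refine inv_eq_of_mul_eq_one_right ?_
      have : κ i ^ 2 * q = -1 := by rw [h1]; field_simp
      linear_combination -this
    have hq1' : q - 1 ≠ 0 := sub_ne_zero.2 hq1
    simp only [fockE, fockF_of_zero hi, fockK, rootPairing_of_zero hi, Pi.add_apply,
      simpleRoot_self, mul_inv, h3, qnum, hi, lt_irrefl, if_false, h2, neg_add, zpow_add₀ hq,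
      zpow_neg, zpow_one, inv_inv]
    have hm : q ^ m i ≠ 0 := zpow_ne_zero _ hq
    field_simp
    ring
  · obtain ⟨k, hk⟩ := exists_pred hi
    simp only [fockE, fockF_of_pred hk, fockK, rootPairing_of_pred hk, Pi.add_apply, Pi.neg_apply,
      simpleRoot_self, simpleRoot_pred hk, hκ i (by omega), qnum, if_pos (show 0 < (i : ℕ) by omega),
      neg_sub, neg_neg, neg_add, zpow_add₀ hq, zpow_sub₀ hq, zpow_neg, zpow_one, one_mul, inv_div]
    have hm : q ^ m i ≠ 0 := zpow_ne_zero _ hq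
    have hm' : q ^ m k ≠ 0 := zpow_ne_zero _ hq
    have hd2 : q ^ 2 - 1 ≠ 0 := fun h => hd (by
      rw [show q - q⁻¹ = (q ^ 2 - 1) / q by field_simp, h, zero_div])
    field_simp
    ring

lemma fock_e_f_ne {γ : ℂ} {i j : Fin n} (h : i ≠ j) (m : Fin n → ℤ) :
    fockE q γ i (m + simpleRoot n j) * fockF q j m =
      fockF q j (m + -simpleRoot n i) * fockE q γ i m := by
  by_cases hij : (i : ℕ) + 1 = j
  · simp only [fockE, fockF_of_pred hij, Pi.add_apply, Pi.neg_apply, simpleRoot_pred hij,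
      simpleRoot_self]
    ring
  · rw [fockE_add_of_ne h hij, fockF_sub_of_ne h.symm hij, mul_comm]

lemma fockGen_rel (hq : q ≠ 0) (hq1 : q ≠ 1) (hd : q - q⁻¹ ≠ 0) {κ : Fin n → ℂ} {γ : ℂ}
    (hκ : ∀ i : Fin n, 0 < (i : ℕ) → κ i = 1)
    (hκ0 : ∀ i : Fin n, (i : ℕ) = 0 → κ i ^ 2 = -q⁻¹ ∧ γ = κ i * q / (q - 1))
    ⦃x y : FreeAlgebra ℂ (UqGen n)⦄ (h : UqRel n q x y) :
    FreeAlgebra.lift ℂ (fockGen q γ κ) x = FreeAlgebra.lift ℂ (fockGen q γ κ) y := by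
  have key : ∀ z, FreeAlgebra.lift ℂ (fockGen q γ κ) (freeGen z) = fockGen q γ κ z := fun z => by
    simp [freeGen]
  have keyq : ∀ (a : ℂ) (z w), FreeAlgebra.lift ℂ (fockGen q γ κ) (qComm a z w) =
      qComm a (FreeAlgebra.lift ℂ (fockGen q γ κ) z) (FreeAlgebra.lift ℂ (fockGen q γ κ) w) :=
    fun a z w => by simp [qComm]
  have hK : ∀ i m, fockK q κ i m ≠ 0 := by
    intro i m
    refine mul_ne_zero ?_ (zpow_ne_zero _ hq)
    by_cases hi : (i : ℕ) = 0
    · intro h0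
      have := (hκ0 i hi).1
      rw [h0] at this
      simp [hq] at this
    · rw [hκ i (by omega)]
      exact one_ne_zero
  cases h <;> simp only [map_mul, map_sub, map_smul, map_one, map_zero, key, keyq, fockGen]
  case k_kinv i =>
    rw [shiftOp_mul, ← shiftOp_one, add_zero]
    congr 1
    exact funext fun m => by rw [add_zero, mul_inv_cancel₀ (hK i m)]
  case kinv_k i =>
    rw [shiftOp_mul, ← shiftOp_one, add_zero]
    congr 1
    exact funext fun m => by rw [add_zero, inv_mul_cancel₀ (hK i m)]
  case k_k i j => exact shiftOp_commute fun m => by rw [add_zero, mul_comm]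
  case k_e i j =>
    rw [shiftOp_mul, shiftOp_mul, shiftOp_smul, add_comm 0]
    congr 1
    exact funext fun m => by rw [add_zero, fockK_sub hq]; ring
  case k_f i j =>
    rw [shiftOp_mul, shiftOp_mul, shiftOp_smul, add_comm 0]
    congr 1
    exact funext fun m => by rw [add_zero, fockK_add hq]; ring
  case e_f_same i =>
    rw [shiftOp_mul, shiftOp_mul, neg_add_cancel, add_neg_cancel, shiftOp_sub, shiftOp_sub,
      shiftOp_smul]
    congr 1
    exact funext fun m => fock_e_f_same hq hq1 hd hκ hκ0 i m
  case e_f_ne i j h => exact shiftOp_commute fun m => fock_e_f_ne h m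
  case serre_e i j h =>
    rw [← serrePoly_eq_qComm hq]
    refine fock_serre_e hq γ ?_
    simp only [rootForm_eq] at h
    split_ifs at h <;> omega
  case serre_f i j h => rw [← serrePoly_eq_qComm hq, fock_serre_f hq h]
  case comm_e i j h =>
    rw [qComm, one_smul, sub_eq_zero]
    simp only [rootForm_eq] at h
    refine shiftOp_commute fun m => ?_
    have hij : i ≠ j := by rintro rfl; split_ifs at h <;> omega
    rw [fockE_sub_of_ne hij (by split_ifs at h <;> omega),
      fockE_sub_of_ne hij.symm (by split_ifs at h <;> omega), mul_comm]
  case comm_f i j h =>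
    rw [qComm, one_smul, sub_eq_zero]
    simp only [rootForm_eq] at h
    refine shiftOp_commute fun m => ?_
    have hij : i ≠ j := by rintro rfl; split_ifs at h <;> omega
    rw [fockF_add_of_ne hij (by split_ifs at h <;> omega),
      fockF_add_of_ne hij.symm (by split_ifs at h <;> omega), mul_comm]
  case serre_short_e h0 h1 => 
    rw [← serrePoly_eq_qComm hq, fock_serre_e hq γ (Or.inl rfl)]; simp [qComm]
  case serre_short_f h0 h1 => 
    rw [← serrePoly_eq_qComm hq, fock_serre_short_f hq rfl rfl]; simp [qComm]

/-- The Fock representation of `U_q(so(2n+1))`. -/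
noncomputable def fockRep (hq : q ≠ 0) (hq1 : q ≠ 1) (hd : q - q⁻¹ ≠ 0) {κ : Fin n → ℂ} {γ : ℂ}
    (hκ : ∀ i : Fin n, 0 < (i : ℕ) → κ i = 1)
    (hκ0 : ∀ i : Fin n, (i : ℕ) = 0 → κ i ^ 2 = -q⁻¹ ∧ γ = κ i * q / (q - 1)) :
    Uq n q →ₐ[ℂ] Module.End ℂ ((Fin n → ℤ) →₀ ℂ) :=
  uqLift (fockGen q γ κ) (fockGen_rel hq hq1 hd hκ hκ0)

end FockModule

/-! ### The homomorphism from the base module to the Fock module -/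

section FockMap

variable {n : ℕ} {q ħ : ℂ} {wt : Fin n → ℂ}

/-- A homomorphism from the base module to the Fock module. -/
structure FockMap (n : ℕ) (q ħ : ℂ) (wt : Fin n → ℂ) where
  /-- the normalization of the shortest simple root vector -/
  γ : ℂ
  /-- the highest weight -/
  κ : Fin n → ℂ
  /-- the Fock representation -/
  rep : Uq n q →ₐ[ℂ] Module.End ℂ ((Fin n → ℤ) →₀ ℂ)
  /-- the homomorphism -/
  map : BaseModule n q ħ wt →ₗ[ℂ] ((Fin n → ℤ) →₀ ℂ)
  γ_ne_zero : γ ≠ 0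
  rep_gen : ∀ x, rep (uqGen n q x) = fockGen q γ κ x
  map_baseVec : map (baseVec n q ħ wt) = Finsupp.single 0 1
  map_act : ∀ a x, map (a • x) = rep a (map x)

/-- The vector `x_0` satisfies all defining relations of `1_λ`: since `[0] = 0` it is killed by
every `e_α` and by `f_α` for `α` long, and the quadratic Serre operator is identically zero. -/
lemma nonempty_fockMap (hn : 0 < n) (hq : q ≠ 0) (hq1 : q ≠ 1) (hd : q - q⁻¹ ≠ 0)
    (hwt : ∀ i, Complex.exp (ħ * (2 * wt i)) = -q⁻¹)
    (hwt' : ∀ i : Fin n, 0 < (i : ℕ) → weightRoot wt i = 0) :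
    Nonempty (FockMap n q ħ wt) := by
  set κ : Fin n → ℂ := fun i => Complex.exp (ħ * weightRoot wt i) with hκdef
  set γ : ℂ := κ ⟨0, hn⟩ * q / (q - 1) with hγ
  have hκ : ∀ i : Fin n, 0 < (i : ℕ) → κ i = 1 := fun i hi => by
    simp only [hκdef, hwt' i hi, mul_zero, Complex.exp_zero]
  have hκ0 : ∀ i : Fin n, (i : ℕ) = 0 → κ i ^ 2 = -q⁻¹ ∧ γ = κ i * q / (q - 1) := by
    intro i hi
    obtain rfl : i = ⟨0, hn⟩ := Fin.ext hi
    refine ⟨?_, rfl⟩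
    have h := sum_simpleRoot_mul (⟨0, hn⟩ : Fin n) wt
    rw [dif_neg (lt_irrefl 0), sub_zero] at h
    rw [← hwt ⟨0, hn⟩, hκdef]
    simp only [weightRoot]
    rw [h, ← Complex.exp_nat_mul]
    congr 1
    push_cast
    ring
  set ρ := fockRep (n := n) hq hq1 hd hκ hκ0 with hρ
  have hρg : ∀ x, ρ (uqGen n q x) = fockGen q γ κ x := fun x => uqLift_gen _ _ x
  -- Pulling the action back along `ρ` allows the universal properties of the two quotients to be
  -- used over the quantum group itself.
  let _ : Module (Uq n q) ((Fin n → ℤ) →₀ ℂ) := Module.compHom _ ρ.toRingHom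
  have hsmul : ∀ (a : Uq n q) (g : (Fin n → ℤ) →₀ ℂ), a • g = ρ a g := fun _ _ => rfl
  have : IsScalarTower ℂ (Uq n q) ((Fin n → ℤ) →₀ ℂ) := ⟨fun r a g => by
    rw [hsmul, hsmul, map_smul, LinearMap.smul_apply]⟩
  let φ₀ : Uq n q →ₗ[Uq n q] ((Fin n → ℤ) →₀ ℂ) :=
    LinearMap.toSpanSingleton (Uq n q) _ (Finsupp.single 0 1)
  have hφ₀ : ∀ a, φ₀ a = ρ a (Finsupp.single 0 1) := fun a => rfl
  have h1 : vermaIdeal n q ħ wt ≤ LinearMap.ker φ₀ := by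
    rw [vermaIdeal, Submodule.span_le]
    rintro _ (⟨i, rfl⟩ | ⟨i, rfl⟩)
    · simp [hφ₀, hρg, fockGen, shiftOp_single, fockE, qnum_zero]
    · simp [hφ₀, hρg, fockGen, shiftOp_single, fockK, rootPairing, κ]
  let φ₁ : Verma n q ħ wt →ₗ[Uq n q] ((Fin n → ℤ) →₀ ℂ) := (vermaIdeal n q ħ wt).liftQ φ₀ h1
  have hφ₁ : φ₁ (vermaVec n q ħ wt) = Finsupp.single 0 1 := by
    rw [vermaVec, Submodule.liftQ_apply, hφ₀, map_one, Module.End.one_apply]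
  have h2 : baseSubmodule n q ħ wt ≤ LinearMap.ker φ₁ := by
    rw [baseSubmodule, Submodule.span_le]
    rintro _ (⟨i, hi, rfl⟩ | ⟨h0, h1, rfl⟩)
    · obtain ⟨k, hk⟩ := exists_pred hi.ne'
      simp [hφ₁, hsmul, hρg, fockGen, shiftOp_single, fockF_of_pred hk, qnum_zero]
    · rw [SetLike.mem_coe, LinearMap.mem_ker, map_smul, hφ₁, hsmul]
      have : ρ (qComm q⁻¹ (uqF n q ⟨0, h0⟩) (qComm q (uqF n q ⟨0, h0⟩) (uqF n q ⟨1, h1⟩))) =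
          serrePoly q (ρ (uqF n q ⟨0, h0⟩)) (ρ (uqF n q ⟨1, h1⟩)) := by
        rw [serrePoly_eq_qComm hq]
        simp [qComm]
      rw [this, hρg, hρg, fockGen, fockGen, fock_serre_short_f hq rfl rfl, LinearMap.zero_apply]
  let φ₂ : BaseModule n q ħ wt →ₗ[Uq n q] ((Fin n → ℤ) →₀ ℂ) :=
    (baseSubmodule n q ħ wt).liftQ φ₁ h2
  refine ⟨⟨γ, κ, ρ, φ₂.restrictScalars ℂ, ?_, hρg, ?_, fun a x => φ₂.map_smul a x⟩⟩
  · exact div_ne_zero (mul_ne_zero (Complex.exp_ne_zero _) hq) (sub_ne_zero.2 hq1)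
  · exact hφ₁

/-- The two `q`-numbers in a `q⁻¹`-commutator collapse to a single power of `q`, which never
vanishes. -/
lemma qnum_sub (hq : q ≠ 0) (hd : q - q⁻¹ ≠ 0) (k : ℤ) :
    qnum q k - q⁻¹ * qnum q (k + 1) = -(q * q ^ k)⁻¹ := by
  simp only [qnum, neg_add, zpow_add₀ hq, zpow_one, zpow_neg]
  have hm : q ^ k ≠ 0 := zpow_ne_zero _ hq
  have hd2 : q ^ 2 - 1 ≠ 0 := fun h => hd (by
    rw [show q - q⁻¹ = (q ^ 2 - 1) / q by field_simp, h, zero_div])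
  field_simp
  ring

lemma single_add_simpleRoot {k : ℕ} (h : k + 1 < n) :
    (Pi.single ⟨k, Nat.lt_of_succ_lt h⟩ 1 : Fin n → ℤ) + simpleRoot n ⟨k + 1, h⟩ =
      Pi.single ⟨k + 1, h⟩ 1 := by
  funext i
  simp only [Pi.add_apply, Pi.single_apply, simpleRoot, Fin.ext_iff]
  split_ifs <;> omega

namespace FockMap

variable (D : FockMap n q ħ wt)

/-- The dependence of `P` on earlier coordinates only is carried through the induction because
`α_{k+1}` changes just the coordinates `k` and `k + 1`, so `P` factors out of the commutator. -/
lemma exists_rep_uqFEps (hq : q ≠ 0) (hd : q - q⁻¹ ≠ 0) (k : ℕ) (hk : k < n) :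
    ∃ P : (Fin n → ℤ) → ℂ, (∀ m, P m ≠ 0) ∧
      (∀ m m', (∀ i : Fin n, (i : ℕ) < k → m i = m' i) → P m = P m') ∧
      D.rep (uqFEps n q k hk) = shiftOp P (Pi.single ⟨k, hk⟩ 1) := by
  induction k with
  | zero =>
    refine ⟨fun _ => 1, fun _ => one_ne_zero, fun _ _ _ => rfl, ?_⟩
    rw [uqFEps, D.rep_gen, fockGen]
    have h1 : fockF q (⟨0, hk⟩ : Fin n) = fun _ => 1 := funext fun m => fockF_of_zero rfl m
    have h2 : simpleRoot n ⟨0, hk⟩ = Pi.single ⟨0, hk⟩ 1 := by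
      funext i
      rcases eq_or_ne i ⟨0, hk⟩ with rfl | hi
      · rw [simpleRoot_self, Pi.single_eq_same]
      · rw [simpleRoot_of_ne (fun h => hi (Fin.ext h)) (by simp), Pi.single_eq_of_ne hi]
    rw [h1, h2]
  | succ k ih =>
    obtain ⟨P, hP, hPm, hrep⟩ := ih (Nat.lt_of_succ_lt hk)
    refine ⟨fun m => P m * -(q * q ^ m ⟨k, Nat.lt_of_succ_lt hk⟩)⁻¹, fun m => ?_,
      fun m m' h => ?_, ?_⟩
    · exact mul_ne_zero (hP m) (neg_ne_zero.2 (inv_ne_zero (mul_ne_zero hq (zpow_ne_zero _ hq))))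
    · simp only
      rw [hPm m m' fun i hi => h i (by omega), h ⟨k, Nat.lt_of_succ_lt hk⟩ (by simp)]
    · have h1 : D.rep (qComm q⁻¹ (uqFEps n q k (Nat.lt_of_succ_lt hk)) (uqF n q ⟨k + 1, hk⟩)) =
          qComm q⁻¹ (shiftOp P (Pi.single ⟨k, Nat.lt_of_succ_lt hk⟩ 1))
            (shiftOp (fockF q ⟨k + 1, hk⟩) (simpleRoot n ⟨k + 1, hk⟩)) := by
        simp only [qComm, map_sub, map_mul, map_smul, hrep, D.rep_gen, fockGen]
      rw [uqFEps, h1, qComm, shiftOp_mul, shiftOp_mul, add_comm (simpleRoot n _),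
        single_add_simpleRoot hk, shiftOp_smul, shiftOp_sub]
      congr 1
      funext m
      have h2 : ∀ m : Fin n → ℤ, fockF q ⟨k + 1, hk⟩ m = qnum q (m ⟨k, Nat.lt_of_succ_lt hk⟩) :=
        fun m => fockF_of_pred (j := ⟨k, Nat.lt_of_succ_lt hk⟩) rfl m
      have h3 : P (m + simpleRoot n ⟨k + 1, hk⟩) = P m := by
        refine hPm _ _ fun i hi => ?_
        rw [Pi.add_apply, simpleRoot_of_ne (by simp; omega) (by simp; omega), add_zero]
      rw [h2, h2, h3, Pi.add_apply, Pi.single_eq_same, ← qnum_sub hq hd]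
      ring

lemma exists_rep_list (hq : q ≠ 0) (hd : q - q⁻¹ ≠ 0) (m : Fin n → ℕ) (L : List (Fin n)) :
    ∃ c : ℂ, c ≠ 0 ∧
      D.rep (L.map fun i : Fin n => uqFEps n q i i.isLt ^ m i).prod (Finsupp.single 0 1) =
      Finsupp.single (L.map fun i => (Pi.single i (m i : ℤ) : Fin n → ℤ)).sum c := by
  induction L with
  | nil => exact ⟨1, one_ne_zero, by simp⟩
  | cons i L ih =>
    obtain ⟨c, hc, h⟩ := ih
    obtain ⟨P, hP, -, hrep⟩ := D.exists_rep_uqFEps hq hd i i.isLt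
    refine ⟨c * ∏ t ∈ Finset.range (m i), P ((L.map fun i =>
      (Pi.single i (m i : ℤ) : Fin n → ℤ)).sum + t • Pi.single i 1),
      mul_ne_zero hc (Finset.prod_ne_zero_iff.2 fun t _ => hP _), ?_⟩
    rw [List.map_cons, List.prod_cons, map_mul, Module.End.mul_apply, h, map_pow, hrep,
      shiftOp_pow_single, List.map_cons, List.sum_cons, add_comm]
    congr 2
    rw [← Pi.single_smul, nsmul_one]

lemma exists_map_uqMonomial (hq : q ≠ 0) (hd : q - q⁻¹ ≠ 0) (m : Fin n → ℕ) :
    ∃ c : ℂ, c ≠ 0 ∧ D.map (uqMonomial n q m • baseVec n q ħ wt) =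
      Finsupp.single (fun i => (m i : ℤ)) c := by
  obtain ⟨c, hc, h⟩ := D.exists_rep_list hq hd m (List.finRange n)
  refine ⟨c, hc, ?_⟩
  rw [D.map_act, D.map_baseVec, uqMonomial, List.ofFn_eq_map, h]
  congr 1
  rw [← List.ofFn_eq_map, List.sum_ofFn, Finset.univ_sum_single]

end FockMap

end FockMap

/-! ### Coefficients of iterated shifts and diagonal forms -/

section ShiftEvaluation

variable {ι : Type*}

lemma shiftOp_pow_apply (a : (ι → ℤ) → ℂ) (d : ι → ℤ) (p : ℕ) (g : (ι → ℤ) →₀ ℂ) (k : ι → ℤ) :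
    (shiftOp a d ^ p) g (k + p • d) = g k * ∏ t ∈ Finset.range p, a (k + t • d) := by
  induction g using Finsupp.induction_linear with
  | zero => simp
  | add g h hg hh => rw [_root_.map_add (shiftOp a d ^ p), Finsupp.add_apply, hg, hh, Finsupp.add_apply, add_mul]
  | single m c =>
    rw [shiftOp_pow_single]
    by_cases hmk : m = k
    · rw [hmk, Finsupp.single_eq_same, Finsupp.single_eq_same]
    · rw [Finsupp.single_eq_of_ne (fun h => hmk (add_right_cancel h).symm),
        Finsupp.single_eq_of_ne (Ne.symm hmk), zero_mul]

/-- The diagonal bilinear form with the given weights. -/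
noncomputable def diagForm (b : (ι → ℤ) → ℂ) : LinearMap.BilinForm ℂ ((ι → ℤ) →₀ ℂ) :=
  Finsupp.linearCombination ℂ fun k => b k • (Finsupp.lapply k : ((ι → ℤ) →₀ ℂ) →ₗ[ℂ] ℂ)

lemma diagForm_single (b : (ι → ℤ) → ℂ) (m : ι → ℤ) (c : ℂ) (h : (ι → ℤ) →₀ ℂ) :
    diagForm b (Finsupp.single m c) h = c * (b m * h m) := by
  simp [diagForm]

lemma diagForm_comm (b : (ι → ℤ) → ℂ) (g h : (ι → ℤ) →₀ ℂ) :
    diagForm b g h = diagForm b h g := by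
  induction g using Finsupp.induction_linear with
  | zero => simp
  | add g g' hg hg' => rw [map_add, LinearMap.add_apply, hg, hg', map_add]
  | single m c =>
    induction h using Finsupp.induction_linear with
    | zero => simp
    | add g g' hg hg' => rw [map_add, hg, hg', map_add, LinearMap.add_apply]
    | single m' c' =>
      rw [diagForm_single, diagForm_single]
      by_cases hm : m = m'
      · subst hm; simp only [Finsupp.single_eq_same]; ring
      · rw [Finsupp.single_eq_of_ne hm, Finsupp.single_eq_of_ne (Ne.symm hm)]; simp

lemma diagForm_eq_zero {b : (ι → ℤ) → ℂ} {g h : (ι → ℤ) →₀ ℂ} (hgh : ∀ k, g k * h k = 0) :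
    diagForm b g h = 0 := by
  rw [diagForm, Finsupp.linearCombination_apply, Finsupp.sum, LinearMap.sum_apply]
  refine Finset.sum_eq_zero fun k _ => ?_
  simp only [LinearMap.smul_apply, Finsupp.lapply_apply, smul_eq_mul]
  linear_combination b k * hgh k

end ShiftEvaluation

/-! ### Supports in the Fock module: kernels of `e`-powers and images of `f`-powers -/

namespace FockMap

variable {n : ℕ} {q ħ : ℂ} {wt : Fin n → ℂ} (D : FockMap n q ħ wt)

/-- The span of the ordered monomials with exponents in a given set. -/
noncomputable def monomialSpan (n : ℕ) (q ħ : ℂ) (wt : Fin n → ℂ) (s : Set (Fin n → ℕ)) :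
    Submodule ℂ (BaseModule n q ħ wt) :=
  Submodule.span ℂ ((fun m => uqMonomial n q m • baseVec n q ħ wt) '' s)

lemma map_mem_of_mem_monomialSpan (hq : q ≠ 0) (hd : q - q⁻¹ ≠ 0) {s : Set (Fin n → ℕ)}
    {x : BaseModule n q ħ wt} (hx : x ∈ monomialSpan n q ħ wt s) {k : Fin n → ℤ}
    (hk : D.map x k ≠ 0) : ∃ m ∈ s, k = fun i => (m i : ℤ) := by
  induction hx using Submodule.span_induction with
  | mem x hx =>
    obtain ⟨m, hm, rfl⟩ := hx
    obtain ⟨c, -, h⟩ := D.exists_map_uqMonomial hq hd m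
    simp only [h] at hk
    refine ⟨m, hm, ?_⟩
    by_contra h'
    exact hk (Finsupp.single_eq_of_ne h')
  | zero => simp at hk
  | add x y _ _ hx hy =>
    rw [map_add, Finsupp.add_apply] at hk
    by_cases h : D.map x k = 0
    · exact hy (by simpa [h] using hk)
    · exact hx h
  | smul r x _ hx =>
    rw [_root_.map_smul, Finsupp.smul_apply] at hk
    exact hx (right_ne_zero_of_mul hk)

/-- The standing assumptions: the rank is positive and `q` is not a root of unity. -/
structure IsGeneric (n : ℕ) (q : ℂ) : Prop where
  pos : 0 < n
  ne_zero : q ≠ 0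
  pow_ne_one : ∀ k : ℕ, 0 < k → q ^ k ≠ 1

lemma IsGeneric.sub_inv_ne_zero (h : IsGeneric n q) : q - q⁻¹ ≠ 0 := by
  intro h'
  refine h.pow_ne_one 2 (by norm_num) ?_
  have hq := h.ne_zero
  field_simp at h'
  linear_combination h'

lemma IsGeneric.qnum_ne_zero (h : IsGeneric n q) {k : ℤ} (hk : k ≠ 0) : qnum q k ≠ 0 :=
  fun h' => hk ((qnum_eq_zero h.ne_zero h.pow_ne_one h.sub_inv_ne_zero).1 h')

lemma mem_monomialSpan_univ (hg : IsGeneric n q) (x : BaseModule n q ħ wt) :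
    x ∈ monomialSpan n q ħ wt Set.univ := by
  rw [monomialSpan, Set.image_univ,
    span_uqMonomial_eq_top hg.pos hg.ne_zero hg.pow_ne_one]
  exact Submodule.mem_top

/-- Monomials map to nonzero multiples of distinct basis vectors, so a coefficient of an expansion
of `x` is nonzero exactly where `D.map x` is. -/
lemma mem_monomialSpan (hg : IsGeneric n q) {s : Set (Fin n → ℕ)} {x : BaseModule n q ħ wt}
    (h : ∀ m : Fin n → ℕ, D.map x (fun i => (m i : ℤ)) ≠ 0 → m ∈ s) :
    x ∈ monomialSpan n q ħ wt s := by
  have hx := mem_monomialSpan_univ hg x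
  rw [monomialSpan, Set.image_univ, Finsupp.mem_span_range_iff_exists_finsupp] at hx
  obtain ⟨a, rfl⟩ := hx
  refine Submodule.sum_mem _ fun m hm => Submodule.smul_mem _ _ (Submodule.subset_span ⟨m, ?_, rfl⟩)
  refine h m ?_
  obtain ⟨c, hc, hmc⟩ := D.exists_map_uqMonomial hg.ne_zero hg.sub_inv_ne_zero m
  rw [Finsupp.sum, map_sum, Finsupp.finsetSum_apply, Finset.sum_eq_single m]
  · rw [_root_.map_smul, hmc, Finsupp.smul_apply, Finsupp.single_eq_same]
    exact mul_ne_zero (Finsupp.mem_support_iff.1 hm) hc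
  · intro m' _ hm'
    obtain ⟨c', -, hmc'⟩ := D.exists_map_uqMonomial hg.ne_zero hg.sub_inv_ne_zero m'
    rw [_root_.map_smul, hmc', Finsupp.smul_apply, Finsupp.single_eq_of_ne, smul_zero]
    intro h'
    exact hm' (funext fun i => by have := congrFun h' i; simpa using this.symm)
  · exact fun h => absurd hm h

lemma map_injective (hg : IsGeneric n q) : Function.Injective D.map := by
  rw [injective_iff_map_eq_zero]
  intro x hx
  -- A vector with zero image has empty support, so it lies in the span of no monomials.
  have : x ∈ monomialSpan n q ħ wt ∅ := D.mem_monomialSpan hg (by simp [hx])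
  simpa [monomialSpan] using this

lemma exists_of_map_ne_zero (hg : IsGeneric n q) {x : BaseModule n q ħ wt} {k : Fin n → ℤ}
    (hk : D.map x k ≠ 0) : ∃ m : Fin n → ℕ, k = fun i => (m i : ℤ) := by
  obtain ⟨m, -, hm⟩ := D.map_mem_of_mem_monomialSpan hg.ne_zero hg.sub_inv_ne_zero
    (mem_monomialSpan_univ hg x) hk
  exact ⟨m, hm⟩

lemma mem_monomialSpan_iff (hg : IsGeneric n q) {s : Set (Fin n → ℕ)} {x : BaseModule n q ħ wt} :
    x ∈ monomialSpan n q ħ wt s ↔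
      ∀ m : Fin n → ℕ, D.map x (fun i => (m i : ℤ)) ≠ 0 → m ∈ s := by
  refine ⟨fun hx m hm => ?_, D.mem_monomialSpan hg⟩
  obtain ⟨m', hm', h⟩ :=
    D.map_mem_of_mem_monomialSpan hg.ne_zero hg.sub_inv_ne_zero hx hm
  have : m = m' := funext fun i => by have := congrFun h i; simpa using this
  rwa [this]

lemma exists_map_eq_single (hg : IsGeneric n q) (m : Fin n → ℕ) :
    ∃ x ∈ monomialSpan n q ħ wt {m}, D.map x = Finsupp.single (fun i => (m i : ℤ)) 1 := by
  obtain ⟨c, hc, h⟩ := D.exists_map_uqMonomial hg.ne_zero hg.sub_inv_ne_zero m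
  refine ⟨c⁻¹ • uqMonomial n q m • baseVec n q ħ wt,
    Submodule.smul_mem _ _ (Submodule.subset_span ⟨m, rfl, rfl⟩), ?_⟩
  rw [_root_.map_smul, h, Finsupp.smul_single, smul_eq_mul, inv_mul_cancel₀ hc]

lemma isCompl_monomialSpan (D : FockMap n q ħ wt) (hg : IsGeneric n q) (s : Set (Fin n → ℕ)) :
    IsCompl (monomialSpan n q ħ wt s) (monomialSpan n q ħ wt sᶜ) := by
  constructor
  · rw [Submodule.disjoint_def]
    intro x hx hx'
    rw [D.mem_monomialSpan_iff hg] at hx hx'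
    refine (injective_iff_map_eq_zero _).1 (D.map_injective hg) x (Finsupp.ext fun k => ?_)
    by_contra hk
    obtain ⟨m, rfl⟩ := D.exists_of_map_ne_zero hg hk
    exact hx' m hk (hx m hk)
  · rw [codisjoint_iff, monomialSpan, monomialSpan, ← Submodule.span_union, ← Set.image_union,
      Set.union_compl_self, eq_top_iff]
    exact fun x _ => mem_monomialSpan_univ hg x

lemma map_uqE_pow (i : Fin n) (p : ℕ) (x : BaseModule n q ħ wt) : D.map (uqE n q i ^ p • x) =
    (shiftOp (fockE q D.γ i) (-simpleRoot n i) ^ p) (D.map x) := by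
  rw [D.map_act, map_pow, D.rep_gen, fockGen]

lemma map_uqF_pow (i : Fin n) (p : ℕ) (x : BaseModule n q ħ wt) : D.map (uqF n q i ^ p • x) =
    (shiftOp (fockF q i) (simpleRoot n i) ^ p) (D.map x) := by
  rw [D.map_act, map_pow, D.rep_gen, fockGen]

/-- The factor at step `t` is a nonzero multiple of `[m_i - t]`, so the product vanishes as soon as
`t` can reach `m_i`. -/
lemma prod_fockE_eq_zero_iff (hg : IsGeneric n q) (i : Fin n) (p : ℕ) (m : Fin n → ℕ) :
    ∏ t ∈ Finset.range p, fockE q D.γ i ((fun j => (m j : ℤ)) + t • -simpleRoot n i) = 0 ↔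
      m i < p := by
  rw [Finset.prod_eq_zero_iff]
  have h : ∀ t : ℕ, fockE q D.γ i ((fun j => (m j : ℤ)) + t • -simpleRoot n i) = 0 ↔ t = m i := by
    intro t
    have h1 : (if 0 < (i : ℕ) then 1 else D.γ) ≠ 0 := by
      split_ifs
      · exact one_ne_zero
      · exact D.γ_ne_zero
    rw [fockE, mul_eq_zero, or_iff_right h1,
      qnum_eq_zero hg.ne_zero hg.pow_ne_one hg.sub_inv_ne_zero]
    rw [Pi.add_apply, Pi.smul_apply, Pi.neg_apply, simpleRoot_self, nsmul_eq_mul]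
    omega
  simp only [h, Finset.mem_range]
  exact ⟨fun ⟨t, ht, h⟩ => h ▸ ht, fun h => ⟨_, h, rfl⟩⟩

/-- A shift sends distinct lattice points to distinct ones, so there is no cancellation and each
point of the support can be tested separately. -/
lemma uqE_pow_smul_eq_zero_iff (hg : IsGeneric n q) (i : Fin n) (p : ℕ)
    (x : BaseModule n q ħ wt) : uqE n q i ^ p • x = 0 ↔
      ∀ m : Fin n → ℕ, D.map x (fun j => (m j : ℤ)) ≠ 0 → m i < p := by
  rw [← (D.map_injective hg).eq_iff, map_zero, D.map_uqE_pow]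
  constructor
  · intro h m hm
    have h1 := shiftOp_pow_apply (fockE q D.γ i) (-simpleRoot n i) p (D.map x) fun j => (m j : ℤ)
    rw [h, Finsupp.zero_apply, eq_comm, mul_eq_zero, or_iff_right hm] at h1
    exact (D.prod_fockE_eq_zero_iff hg i p m).1 h1
  · intro h
    refine Finsupp.ext fun k => ?_
    have h1 := shiftOp_pow_apply (fockE q D.γ i) (-simpleRoot n i) p (D.map x)
      (k - p • -simpleRoot n i)
    rw [sub_add_cancel] at h1
    rw [h1, Finsupp.zero_apply]
    by_cases h2 : D.map x (k - p • -simpleRoot n i) = 0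
    · rw [h2, zero_mul]
    · obtain ⟨m, hm⟩ := D.exists_of_map_ne_zero hg h2
      rw [hm, (D.prod_fockE_eq_zero_iff hg i p m).2 (h m (hm ▸ h2)), mul_zero]

lemma uqF_pow_smul_mem (D : FockMap n q ħ wt) (hg : IsGeneric n q) (i : Fin n) (p : ℕ)
    (x : BaseModule n q ħ wt) :
    uqF n q i ^ p • x ∈ monomialSpan n q ħ wt {m | p ≤ m i} := by
  rw [D.mem_monomialSpan_iff hg]
  intro m hm
  rw [D.map_uqF_pow] at hm
  have h1 := shiftOp_pow_apply (fockF q i) (simpleRoot n i) p (D.map x)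
    ((fun j => (m j : ℤ)) - p • simpleRoot n i)
  rw [sub_add_cancel] at h1
  rw [h1] at hm
  obtain ⟨m', hm'⟩ := D.exists_of_map_ne_zero hg (left_ne_zero_of_mul hm)
  have h2 := congrFun hm' i
  rw [Pi.sub_apply, Pi.smul_apply, simpleRoot_self, nsmul_eq_mul] at h2
  change p ≤ m i
  omega

/-- The preimage is a multiple of the vector at `m - p α_i`, which stays in `ℕⁿ` because only
coordinate `i` decreases. -/
lemma exists_uqF_pow_smul_eq (D : FockMap n q ħ wt) (hg : IsGeneric n q) (i : Fin n) (p : ℕ)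
    (m : Fin n → ℕ) (hm : p ≤ m i) :
    ∃ x : BaseModule n q ħ wt,
      uqMonomial n q m • baseVec n q ħ wt = uqF n q i ^ p • x := by
  have hpos : ∀ j, 0 ≤ (m j : ℤ) - p * simpleRoot n i j := by
    intro j
    rcases eq_or_ne j i with rfl | hj
    · rw [simpleRoot_self]; omega
    · by_cases h : (j : ℕ) + 1 = i
      · rw [simpleRoot_pred h]; omega
      · rw [simpleRoot_of_ne (fun h => hj (Fin.ext h)) h]; omega
  let m' : Fin n → ℕ := fun j => ((m j : ℤ) - p * simpleRoot n i j).toNat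
  have hm' : (fun j => (m' j : ℤ)) + p • simpleRoot n i = fun j => (m j : ℤ) := by
    funext j
    rw [Pi.add_apply, Pi.smul_apply, nsmul_eq_mul, Int.toNat_of_nonneg (hpos j)]
    ring
  obtain ⟨x, -, hx⟩ := D.exists_map_eq_single hg m'
  obtain ⟨c, -, hc⟩ := D.exists_map_uqMonomial hg.ne_zero hg.sub_inv_ne_zero m
  set d : ℂ := ∏ t ∈ Finset.range p, fockF q i ((fun j => (m' j : ℤ)) + t • simpleRoot n i)
  -- After `t < p` steps the coordinate preceding `i` is still `m_{i-1} + p - t > 0`, so no factor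
  -- `[0]` occurs.
  have hd : d ≠ 0 := by
    refine Finset.prod_ne_zero_iff.2 fun t ht => ?_
    by_cases hi : (i : ℕ) = 0
    · rw [fockF_of_zero hi]; exact one_ne_zero
    · obtain ⟨j, hj⟩ := exists_pred hi
      rw [fockF_of_pred hj]
      refine hg.qnum_ne_zero ?_
      have h1 := congrFun hm' j
      rw [Pi.add_apply, Pi.smul_apply, simpleRoot_pred hj, nsmul_eq_mul] at h1 ⊢
      have := Finset.mem_range.1 ht
      omega
  refine ⟨(c * d⁻¹) • x, D.map_injective hg ?_⟩
  rw [smul_algebra_smul_comm, _root_.map_smul D.map, D.map_uqF_pow, hx, shiftOp_pow_single, hm', hc,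
    Finsupp.smul_single, smul_eq_mul, one_mul, mul_assoc, inv_mul_cancel₀ hd, mul_one]

end FockMap

/-! ### Norms of the basis vectors -/

section FockNorm

variable {n : ℕ} {q γ : ℂ}

/-- The squared norm of a basis vector of the Fock module. -/
noncomputable def fockNorm (q γ : ℂ) (m : Fin n → ℕ) : ℂ :=
  ∏ i, ∏ t ∈ Finset.range (m i), γ * qnum q (t + 1)

lemma fockNorm_add_single (m : Fin n → ℕ) (i : Fin n) :
    fockNorm q γ (m + Pi.single i 1) = fockNorm q γ m * (γ * qnum q (m i + 1)) := by
  rw [fockNorm, fockNorm, ← Finset.mul_prod_erase _ _ (Finset.mem_univ i),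
    ← Finset.mul_prod_erase Finset.univ (fun j => ∏ t ∈ Finset.range (m j), γ * qnum q (t + 1))
      (Finset.mem_univ i), Pi.add_apply, Pi.single_eq_same, Finset.prod_range_succ,
    Finset.prod_congr rfl (g := fun j => ∏ t ∈ Finset.range (m j), γ * qnum q (t + 1))]
  · ring
  · intro j hj
    rw [Pi.add_apply, Pi.single_eq_of_ne (Finset.ne_of_mem_erase hj), add_zero]

lemma fockNorm_ne_zero (hγ : γ ≠ 0) (hg : FockMap.IsGeneric n q) (m : Fin n → ℕ) :
    fockNorm q γ m ≠ 0 :=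
  Finset.prod_ne_zero_iff.2 fun _ _ => Finset.prod_ne_zero_iff.2 fun _ _ =>
    mul_ne_zero hγ (hg.qnum_ne_zero (by omega))

/-- This is adjointness of `e_{α_i}` and `f_{α_i}` on basis vectors; it dictates the factor `γ` for
each particle in `fockNorm`. -/
lemma fockE_mul_fockNorm {i : Fin n} {m m' : Fin n → ℕ}
    (h : ∀ j, (m j : ℤ) = m' j + simpleRoot n i j) :
    fockE q γ i (fun j => (m j : ℤ)) * fockNorm q γ m' =
      fockNorm q γ m * fockF q i (fun j => (m' j : ℤ)) := by
  have hi := h i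
  rw [simpleRoot_self] at hi
  by_cases h0 : (i : ℕ) = 0
  · have hm : m = m' + Pi.single i 1 := by
      funext j
      have hj := h j
      rcases eq_or_ne j i with rfl | hji
      · rw [Pi.add_apply, Pi.single_eq_same]; omega
      · rw [simpleRoot_of_ne (fun h => hji (Fin.ext h)) (by omega)] at hj
        rw [Pi.add_apply, Pi.single_eq_of_ne hji]; omega
    rw [fockF_of_zero h0, fockE, if_neg (by omega), hi, hm, fockNorm_add_single]
    ring
  · obtain ⟨k, hk⟩ := exists_pred h0
    have hki : k ≠ i := by rintro rfl; omega
    have hk' := h k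
    rw [simpleRoot_pred hk] at hk'
    -- The common part of the two exponents: `m = m₀ + ε_i` and `m' = m₀ + ε_k`.
    let m₀ : Fin n → ℕ := fun j => if j = k then m k else m' j
    have hm : m = m₀ + Pi.single i 1 := by
      funext j
      have hj := h j
      simp only [m₀, Pi.add_apply]
      rcases eq_or_ne j i with rfl | hji
      · rw [Pi.single_eq_same, if_neg hki.symm]; omega
      · rw [Pi.single_eq_of_ne hji]
        rcases eq_or_ne j k with rfl | hjk
        · rw [if_pos rfl, add_zero]
        · rw [simpleRoot_of_ne (fun h => hji (Fin.ext h))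
            (fun h => hjk (Fin.ext (by omega)))] at hj
          rw [if_neg hjk]; omega
    have hm' : m' = m₀ + Pi.single k 1 := by
      funext j
      simp only [m₀, Pi.add_apply]
      rcases eq_or_ne j k with rfl | hjk
      · rw [Pi.single_eq_same, if_pos rfl]; omega
      · rw [Pi.single_eq_of_ne hjk, if_neg hjk, add_zero]
    have h1 : (m i : ℤ) = m₀ i + 1 := by rw [hm, Pi.add_apply, Pi.single_eq_same]; simp
    have h2 : (m' k : ℤ) = m₀ k + 1 := by rw [hm', Pi.add_apply, Pi.single_eq_same]; simp
    rw [fockF_of_pred hk, fockE, if_pos (by omega), h1, h2, hm, hm', fockNorm_add_single,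
      fockNorm_add_single]
    ring

end FockNorm

/-! ### Existence, uniqueness and non-degeneracy of the contravariant form -/

section ContravariantForm

variable {n : ℕ} {q ħ : ℂ} {wt : Fin n → ℂ}

lemma uqOmega_unop_gen (hq : q ≠ 0) (x : UqGen n) :
    (uqOmega n q hq (uqGen n q x)).unop = (omegaGen n q x).unop := by
  rw [uqOmega_gen]

/-- Pairing `1_λ` with `f_α y` gives `(e_α 1_λ, y) = 0`, so pairing with `1_λ` is determined on all
words; contravariance and cyclicity do the rest. -/
lemma IsContravariantForm.unique (hq : q ≠ 0) {B B' : LinearMap.BilinForm ℂ (BaseModule n q ħ wt)}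
    (hB : IsContravariantForm hq B) (hB' : IsContravariantForm hq B') : B = B' := by
  have key : ∀ {B : LinearMap.BilinForm ℂ (BaseModule n q ħ wt)}, IsContravariantForm hq B →
      ∀ i y, B (baseVec n q ħ wt) (uqF n q i • y) = 0 := by
    intro B hB i y
    have h := hB.2 (uqE n q i) (baseVec n q ħ wt) y
    rw [uqE_smul_baseVec, map_zero, LinearMap.zero_apply, uqOmega_unop_gen] at h
    exact h.symm
  have h1 : ∀ y, B (baseVec n q ħ wt) y = B' (baseVec n q ħ wt) y := by
    let S := LinearMap.ker (B (baseVec n q ħ wt) - B' (baseVec n q ħ wt))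
    have hS : S = ⊤ := by
      refine words_induction hq S ?_ fun i x _ => ?_
      · rw [LinearMap.mem_ker, LinearMap.sub_apply, hB.1, hB'.1, sub_self]
      · rw [LinearMap.mem_ker, LinearMap.sub_apply, key hB, key hB', sub_self]
    intro y
    have hy : y ∈ S := hS ▸ Submodule.mem_top
    rwa [LinearMap.mem_ker, LinearMap.sub_apply, sub_eq_zero] at hy
  refine LinearMap.ext₂ fun x y => ?_
  obtain ⟨a, rfl⟩ := exists_smul_baseVec x
  rw [hB.2, hB'.2, h1]

namespace FockMap

variable (D : FockMap n q ħ wt)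

/-- The contravariant form, in terms of the Fock module. -/
noncomputable def form : LinearMap.BilinForm ℂ (BaseModule n q ħ wt) :=
  -- The value of `toNat` at negative integers is irrelevant: the image of `D.map` is supported on
  -- `ℕⁿ` when `IsGeneric n q` holds.
  (diagForm fun k : Fin n → ℤ => fockNorm q D.γ fun i => (k i).toNat).compl₁₂ D.map D.map

lemma form_comm (x y : BaseModule n q ħ wt) : D.form x y = D.form y x :=
  diagForm_comm _ _ _

lemma form_eq_of_map_single {x : BaseModule n q ħ wt} {m : Fin n → ℕ} {c : ℂ}
    (h : D.map x = Finsupp.single (fun i => (m i : ℤ)) c) (y : BaseModule n q ħ wt) :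
    D.form x y = c * (fockNorm q D.γ m * D.map y (fun i => (m i : ℤ))) := by
  simp [form, h, diagForm_single]

lemma form_eq_zero_of_mem (hg : IsGeneric n q) {s : Set (Fin n → ℕ)} {x y : BaseModule n q ħ wt}
    (hx : x ∈ monomialSpan n q ħ wt s) (hy : y ∈ monomialSpan n q ħ wt sᶜ) :
    D.form x y = 0 := by
  refine diagForm_eq_zero fun k => ?_
  by_contra hk
  obtain ⟨m, rfl⟩ := D.exists_of_map_ne_zero hg (left_ne_zero_of_mul hk)
  exact (D.mem_monomialSpan_iff hg).1 hy m (right_ne_zero_of_mul hk)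
    ((D.mem_monomialSpan_iff hg).1 hx m (left_ne_zero_of_mul hk))

lemma bilinForm_ext (hg : IsGeneric n q) {B B' : LinearMap.BilinForm ℂ (BaseModule n q ħ wt)}
    (h : ∀ m m' : Fin n → ℕ,
      B (uqMonomial n q m • baseVec n q ħ wt) (uqMonomial n q m' • baseVec n q ħ wt) =
      B' (uqMonomial n q m • baseVec n q ħ wt) (uqMonomial n q m' • baseVec n q ħ wt)) :
    B = B' := by
  have hs := span_uqMonomial_eq_top (ħ := ħ) (wt := wt) hg.pos hg.ne_zero hg.pow_ne_one
  refine LinearMap.ext_on_range hs fun m => LinearMap.ext_on_range hs fun m' => h m m'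

lemma map_gen_smul (x : UqGen n) (y : BaseModule n q ħ wt) :
    D.map (uqGen n q x • y) = fockGen q D.γ D.κ x (D.map y) := by
  rw [D.map_act, D.rep_gen]

/-- Both sides vanish unless `m = m' + α_i`, and in that case the equality is `fockE_mul_fockNorm`.
-/
lemma form_uqE (hg : IsGeneric n q) (i : Fin n) (m m' : Fin n → ℕ) :
    D.form (uqE n q i • uqMonomial n q m • baseVec n q ħ wt)
        (uqMonomial n q m' • baseVec n q ħ wt) =
      D.form (uqMonomial n q m • baseVec n q ħ wt)
        (uqF n q i • uqMonomial n q m' • baseVec n q ħ wt) := by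
  obtain ⟨c, -, hc⟩ := D.exists_map_uqMonomial hg.ne_zero hg.sub_inv_ne_zero m
  obtain ⟨c', -, hc'⟩ := D.exists_map_uqMonomial hg.ne_zero hg.sub_inv_ne_zero m'
  rw [form_comm, D.form_eq_of_map_single hc', D.form_eq_of_map_single hc, D.map_gen_smul,
    D.map_gen_smul, hc, hc', fockGen, fockGen, shiftOp_single, shiftOp_single]
  by_cases h : ∀ j, (m j : ℤ) = m' j + simpleRoot n i j
  · have h1 : (fun j => (m' j : ℤ)) + simpleRoot n i = fun j => (m j : ℤ) :=
      funext fun j => (h j).symm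
    have h2 : (fun j => (m j : ℤ)) + -simpleRoot n i = fun j => (m' j : ℤ) := by
      rw [← h1, add_neg_cancel_right]
    rw [h1, h2, Finsupp.single_eq_same, Finsupp.single_eq_same]
    linear_combination c * c' * fockE_mul_fockNorm (q := q) (γ := D.γ) h
  · rw [Finsupp.single_eq_of_ne, Finsupp.single_eq_of_ne]
    · ring
    · exact fun h' => h fun j => congrFun h' j
    · refine fun h' => h fun j => ?_
      have := congrFun h' j
      rw [Pi.add_apply, Pi.neg_apply] at this
      omega

lemma form_diag (hg : IsGeneric n q) {a : Uq n q} (b : (Fin n → ℤ) → ℂ)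
    (ha : D.rep a = shiftOp b 0) (m m' : Fin n → ℕ) :
    D.form (a • uqMonomial n q m • baseVec n q ħ wt) (uqMonomial n q m' • baseVec n q ħ wt) =
      D.form (uqMonomial n q m • baseVec n q ħ wt)
        (a • uqMonomial n q m' • baseVec n q ħ wt) := by
  obtain ⟨c, -, hc⟩ := D.exists_map_uqMonomial hg.ne_zero hg.sub_inv_ne_zero m
  obtain ⟨c', -, hc'⟩ := D.exists_map_uqMonomial hg.ne_zero hg.sub_inv_ne_zero m'
  rw [form_comm, D.form_eq_of_map_single hc', D.form_eq_of_map_single hc, D.map_act a, D.map_act a,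
    hc, hc', ha, shiftOp_single, shiftOp_single, add_zero, add_zero]
  by_cases h : m = m'
  · subst h
    rw [Finsupp.single_eq_same, Finsupp.single_eq_same]
    ring
  · have hne : (fun j => (m j : ℤ)) ≠ fun j => (m' j : ℤ) := fun h' =>
      h (funext fun j => by have := congrFun h' j; simpa using this)
    rw [Finsupp.single_eq_of_ne hne, Finsupp.single_eq_of_ne hne.symm]
    ring

/-- Since `ω` reverses products, the elements satisfying the identity form a subalgebra, so
generators suffice; the case of `f_α` follows from that of `e_α` by symmetry of the form. -/
lemma form_smul (hg : IsGeneric n q) (a : Uq n q) (x y : BaseModule n q ħ wt) :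
    D.form (a • x) y = D.form x ((uqOmega n q hg.ne_zero a).unop • y) := by
  let S : Subalgebra ℂ (Uq n q) :=
    { carrier := {a | ∀ x y, D.form (a • x) y = D.form x ((uqOmega n q hg.ne_zero a).unop • y)}
      mul_mem' := fun {a b} ha hb x y => by
        rw [mul_smul, ha, hb, map_mul, MulOpposite.unop_mul, mul_smul]
      add_mem' := fun {a b} ha hb x y => by
        rw [add_smul, map_add, LinearMap.add_apply, ha, hb, map_add, MulOpposite.unop_add, add_smul,
          map_add]
      algebraMap_mem' := fun r x y => by
        rw [AlgHom.commutes, MulOpposite.algebraMap_apply, MulOpposite.unop_op, algebraMap_smul,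
          algebraMap_smul, _root_.map_smul, LinearMap.smul_apply, _root_.map_smul] }
  have ext : ∀ a b : Uq n q, (∀ m m' : Fin n → ℕ,
      D.form (a • uqMonomial n q m • baseVec n q ħ wt) (uqMonomial n q m' • baseVec n q ħ wt) =
      D.form (uqMonomial n q m • baseVec n q ħ wt)
        (b • uqMonomial n q m' • baseVec n q ħ wt)) →
      ∀ x y, D.form (a • x) y = D.form x (b • y) := by
    intro a b h x y
    exact LinearMap.congr_fun₂ (bilinForm_ext hg
      (B := D.form.compl₁₂ (Algebra.lsmul ℂ ℂ _ a) LinearMap.id)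
      (B' := D.form.compl₁₂ LinearMap.id (Algebra.lsmul ℂ ℂ _ b)) h) x y
  have hS : S = ⊤ := by
    refine subalgebra_eq_top_of_gen S fun g => ?_
    intro x y
    rw [uqOmega_unop_gen]
    cases g with
    | e i => exact ext _ _ (D.form_uqE hg i) x y
    | f i =>
      refine ext _ _ (fun m m' => ?_) x y
      rw [form_comm, D.form_comm (uqMonomial n q m • _)]
      exact (D.form_uqE hg i m' m).symm
    | k i => exact ext _ _ (D.form_diag hg _ (D.rep_gen _)) x y
    | kinv i => exact ext _ _ (D.form_diag hg _ (D.rep_gen _)) x y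
  have ha : a ∈ S := hS ▸ Algebra.mem_top
  exact ha x y

lemma isContravariantForm_form (hg : IsGeneric n q) :
    IsContravariantForm hg.ne_zero D.form := by
  refine ⟨?_, D.form_smul hg⟩
  have h : D.map (baseVec n q ħ wt) =
      Finsupp.single (fun i => (((0 : Fin n → ℕ) i : ℕ) : ℤ)) 1 := by
    rw [D.map_baseVec]; rfl
  rw [D.form_eq_of_map_single h, h, Finsupp.single_eq_same]
  simp [fockNorm]

/-- A nonzero `x` is detected by pairing it with the preimage of a basis vector from its support,
which lies in the same coordinate subspace. -/
lemma form_restrict_nondegenerate (hg : IsGeneric n q) (s : Set (Fin n → ℕ)) :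
    (D.form.restrict (monomialSpan n q ħ wt s)).Nondegenerate := by
  have key : ∀ x ∈ monomialSpan n q ħ wt s, (∀ y ∈ monomialSpan n q ħ wt s, D.form y x = 0) →
      x = 0 := by
    intro x hx h
    refine (injective_iff_map_eq_zero _).1 (D.map_injective hg) x (Finsupp.ext fun k => ?_)
    by_contra hk
    obtain ⟨m, rfl⟩ := D.exists_of_map_ne_zero hg hk
    obtain ⟨y, hy, hym⟩ := D.exists_map_eq_single hg m
    have hm := (D.mem_monomialSpan_iff hg).1 hx m hk
    have h1 := h y (Submodule.span_mono (Set.image_mono (Set.singleton_subset_iff.2 hm)) hy)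
    rw [D.form_eq_of_map_single hym, one_mul] at h1
    exact mul_ne_zero (fockNorm_ne_zero D.γ_ne_zero hg m) hk h1
  refine ⟨fun x hx => Subtype.ext (key x x.2 fun y hy => ?_),
    fun x hx => Subtype.ext (key x x.2 fun y hy => ?_)⟩
  · rw [form_comm]; exact hx ⟨y, hy⟩
  · exact hx ⟨y, hy⟩

end FockMap

end ContravariantForm

/-! ### The ideals and the two summands in monomial terms -/

section Ideals

variable {n : ℕ} {q ħ : ℂ} {wt : Fin n → ℂ}

lemma uqE_pow_mem_idealPlus (hq : q ≠ 0) (l : Fin n → ℕ) (i : Fin n) :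
    uqE n q i ^ (l i + 1) ∈ idealPlus n q hq l := by
  refine ⟨uqMinusF n q i ^ (l i + 1), Ideal.subset_span ⟨i, rfl⟩, ?_⟩
  simp only [SubmonoidClass.coe_pow, uqMinusF, map_pow, uqSigma_gen, sigmaGen]

/-- In `I^+` the powers of `e_{α_i}` stand on the right of each product, so they act first and it
suffices that they kill `x`. -/
lemma mem_plusKernel_iff (hq : q ≠ 0) (l : Fin n → ℕ) (x : BaseModule n q ħ wt) :
    x ∈ plusKernel hq l (BaseModule n q ħ wt) ↔ ∀ i, uqE n q i ^ (l i + 1) • x = 0 := by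
  refine ⟨fun h i => h _ (uqE_pow_mem_idealPlus hq l i), ?_⟩
  rintro h _ ⟨b, hb, rfl⟩
  simp only
  induction hb using Submodule.span_induction with
  | mem b hb =>
    obtain ⟨i, rfl⟩ := hb
    simpa only [SubmonoidClass.coe_pow, uqMinusF, map_pow, uqSigma_gen, sigmaGen] using h i
  | zero => simp
  | add b c _ _ hb hc => rw [Subalgebra.coe_add, map_add, add_smul, hb, hc, add_zero]
  | smul a b _ hb => rw [smul_eq_mul, Subalgebra.coe_mul, map_mul, mul_smul, hb, smul_zero]

/-- The anti-automorphism `ω` moves these powers to the left, where the remaining factor is absorbed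
into the arbitrary vector `x`. -/
lemma omegaImage_eq_span (hq : q ≠ 0) (l : Fin n → ℕ) :
    omegaImage hq l (BaseModule n q ħ wt) = Submodule.span ℂ
      {y | ∃ (i : Fin n) (x : BaseModule n q ħ wt), y = uqF n q i ^ (l i + 1) • x} := by
  have hF : ∀ i : Fin n, (uqOmega n q hq (uqE n q i ^ (l i + 1))).unop = uqF n q i ^ (l i + 1) :=
    fun i => by rw [map_pow, MulOpposite.unop_pow, uqOmega_unop_gen]; rfl
  refine le_antisymm (Submodule.span_le.2 ?_) (Submodule.span_mono ?_)
  · rintro _ ⟨_, ⟨b, hb, rfl⟩, x, rfl⟩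
    simp only [SetLike.mem_coe]
    induction hb using Submodule.span_induction generalizing x with
    | mem b hb =>
      obtain ⟨i, rfl⟩ := hb
      refine Submodule.subset_span ⟨i, x, ?_⟩
      rw [← hF]
      simp only [SubmonoidClass.coe_pow, uqMinusF, map_pow, uqSigma_gen, sigmaGen]
    | zero => simp
    | add b c _ _ hb hc =>
      rw [Subalgebra.coe_add, map_add, map_add, MulOpposite.unop_add, add_smul]
      exact add_mem (hb x) (hc x)
    | smul a b _ hb =>
      rw [smul_eq_mul, Subalgebra.coe_mul, map_mul, map_mul, MulOpposite.unop_mul, mul_smul]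
      exact hb _
  · rintro _ ⟨i, x, rfl⟩
    exact ⟨_, uqE_pow_mem_idealPlus hq l i, x, by rw [hF]⟩

namespace FockMap

lemma plusKernel_eq (D : FockMap n q ħ wt) (hg : IsGeneric n q) (l : Fin n → ℕ) :
    plusKernel hg.ne_zero l (BaseModule n q ħ wt) =
      monomialSpan n q ħ wt {m | ∀ i, m i ≤ l i} := by
  ext x
  rw [mem_plusKernel_iff, D.mem_monomialSpan_iff hg]
  simp only [D.uqE_pow_smul_eq_zero_iff hg, Nat.lt_succ_iff]
  exact forall_comm.trans (forall_congr' fun m => forall_comm)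

lemma omegaImage_eq (D : FockMap n q ħ wt) (hg : IsGeneric n q) (l : Fin n → ℕ) :
    omegaImage hg.ne_zero l (BaseModule n q ħ wt) =
      monomialSpan n q ħ wt {m | ∃ i, l i < m i} := by
  rw [omegaImage_eq_span]
  refine le_antisymm (Submodule.span_le.2 ?_) (Submodule.span_le.2 ?_)
  · rintro _ ⟨i, x, rfl⟩
    have hsub : {m : Fin n → ℕ | l i + 1 ≤ m i} ⊆ {m | ∃ i, l i < m i} := fun m hm => ⟨i, hm⟩
    exact Submodule.span_mono (Set.image_mono hsub) (D.uqF_pow_smul_mem hg i (l i + 1) x)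
  · rintro _ ⟨m, ⟨i, hi⟩, rfl⟩
    obtain ⟨x, hx⟩ := D.exists_uqF_pow_smul_eq hg i (l i + 1) m hi
    exact Submodule.subset_span ⟨i, x, hx⟩

end FockMap

end Ideals

theorem mainTheorem8 (n : ℕ) (hn : 0 < n) (q ħ : ℂ) (hq : q ≠ 0) (hħ : Complex.exp ħ = q)
    (hroot : ∀ k : ℕ, 0 < k → q ^ k ≠ 1)
    -- the highest weight of the base module
    (wt : Fin n → ℂ)
    (hwt : ∀ i, Complex.exp (ħ * (2 * wt i)) = -q⁻¹)
    (hwt' : ∀ i : Fin n, 0 < (i : ℕ) → weightRoot wt i = 0)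
    -- a finite-dimensional module of highest weight `ν`
    (V : Type*) [AddCommGroup V] [Module ℂ V] [Module (Uq n q) V] [IsScalarTower ℂ (Uq n q) V]
    [FiniteDimensional ℂ V] (ν : Fin n → ℂ) (hV : IsOfHighestWeight (q := q) ħ ν V)
    (l : Fin n → ℕ) (hl : ∀ i, (l i : ℂ) = weightCoroot (ν + weylRho n) i - 1) :
    (∃! B : LinearMap.BilinForm ℂ (BaseModule n q ħ wt), IsContravariantForm hq B) ∧
    (∀ B : LinearMap.BilinForm ℂ (BaseModule n q ħ wt), IsContravariantForm hq B →
      (B.restrict (plusKernel hq l (BaseModule n q ħ wt))).Nondegenerate ∧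
      ∀ x ∈ plusKernel hq l (BaseModule n q ħ wt),
        ∀ y ∈ omegaImage hq l (BaseModule n q ħ wt), B x y = 0 ∧ B y x = 0) ∧
    IsCompl (plusKernel hq l (BaseModule n q ħ wt)) (omegaImage hq l (BaseModule n q ħ wt)) ∧
    plusKernel hq l (BaseModule n q ħ wt) =
      Submodule.span ℂ {x | ∃ m : Fin n → ℕ, (∀ i, m i ≤ l i) ∧
        x = uqMonomial n q m • baseVec n q ħ wt} ∧
    omegaImage hq l (BaseModule n q ħ wt) =
      Submodule.span ℂ {x | ∃ m : Fin n → ℕ, (∃ i, l i < m i) ∧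
        x = uqMonomial n q m • baseVec n q ħ wt} := by
  have hg : FockMap.IsGeneric n q := ⟨hn, hq, hroot⟩
  obtain ⟨D⟩ := nonempty_fockMap (ħ := ħ) (wt := wt) hn hq
    (fun h => hroot 1 one_pos (by rw [h, pow_one])) hg.sub_inv_ne_zero hwt hwt'
  have hcompl : {m : Fin n → ℕ | ∃ i, l i < m i} = {m | ∀ i, m i ≤ l i}ᶜ := by
    ext m
    simp
  have himage : ∀ p : (Fin n → ℕ) → Prop, FockMap.monomialSpan n q ħ wt {m | p m} =
      Submodule.span ℂ {x | ∃ m : Fin n → ℕ, p m ∧ x = uqMonomial n q m • baseVec n q ħ wt} := by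
    intro p
    refine congrArg (Submodule.span ℂ) (Set.ext fun x => ?_)
    exact exists_congr fun m => and_congr_right fun _ => eq_comm
  have hplus := D.plusKernel_eq hg l
  have homega := D.omegaImage_eq hg l
  refine ⟨⟨D.form, D.isContravariantForm_form hg,
    fun B hB => hB.unique hq (D.isContravariantForm_form hg)⟩, fun B hB => ?_, ?_,
    hplus.trans (himage _), homega.trans (himage _)⟩
  · obtain rfl := hB.unique hq (D.isContravariantForm_form hg)
    rw [hplus, homega, hcompl]
    refine ⟨D.form_restrict_nondegenerate hg _, fun x hx y hy => ?_⟩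
    have h := D.form_eq_zero_of_mem hg hx hy
    exact ⟨h, by rw [D.form_comm, h]⟩
  · rw [hplus, homega, hcompl]
    exact D.isCompl_monomialSpan hg _
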